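/- All Hilbert spaces are complex. For $S\subseteq B(H,K)$ let $[S]^{-w^*}$ be the weak-$*$ (ultraweak) closure of the linear span of $S$. A *unital dual operator algebra* is a weak-$*$ closed subalgebra of some $B(H)$ having a unit that is a projection. A *ternary ring of operators* (TRO) is a subspace $M\subseteq B(H,K)$ with $MM^*M\subseteq M$. For algebras $A\subseteq B(H)$ and $B\subseteq B(K)$ write: * $A\sim_{TRO}B$ if there is a TRO $M\subseteq B(H,K)$ with $A=[M^*BM]^{-w^*}$ and $B=[MAM^*]^{-w^*}$; * $B\subset_{TRO}A$ if $B\sim_{TRO}pAp$ for some projection $p\in A$; * $A\sim_\Delta B$ (resp. $B\subset_\Delta A$) if there are weak-$*$ continuous completely isometric homomorphisms $\alpha$ of $A$ and $\beta$ of $B$ into algebras of all bounded operators on Hilbert spaces such that $\alpha(A)\sim_{TRO}\beta(B)$ (resp. $\beta(B)\subset_{TRO}\alpha(A)$). On $H=\ell^2(\mathbb Q\cap[0,1])\oplus L^2[0,1]$ let $Q_t^+$, $Q_t^-$, $N_t$ be the projections onto $\ell^2(\mathbb Q\cap[0,t])$, $\ell^2(\mathbb Q\cap[0,t))$ and $L^2[0,t]$,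 let $$\mathcal N=\{Q_t^+\oplus N_t,\ Q_t^-\oplus N_t : 0\le t\le 1\},\qquad A=\mathrm{Alg}(\mathcal N)=\{x\in B(H): (1-l)xl=0\ \ \forall\, l\in\mathcal N\},$$ and let $q$ be the projection of $H$ onto $\ell^2(\mathbb Q\cap[0,\tfrac12])\oplus L^2[0,1]$. Then $\mathcal N$ is a nest (a totally ordered set of projections containing $0$ and $1$ and closed under arbitrary suprema and infima), $A$ is a unital dual operator algebra, $q$ is a projection in $A$, $qAq$ is a unital dual operator algebra, and $$A\subset_\Delta qAq,\qquad qAq\subset_\Delta A,\qquad A\not\sim_\Delta qAq .$$ Consequently, for unital dual operator algebras $A,B$ that are not self-adjoint, $A\subset_\Delta B$ and $B\subset_\Delta A$ do not in general imply $A\sim_\Delta B$; that is, $\subset_\Delta$ is not a partial order on these algebras modulo $\sim_\Delta$. -/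

import Mathlib

open MeasureTheory
open scoped InnerProductSpace Topology

universe u v w

namespace DeltaEmb

noncomputable section

section General

variable {H : Type u} [NormedAddCommGroup H] [InnerProductSpace ℂ H]
variable {K : Type v} [NormedAddCommGroup K] [InnerProductSpace ℂ K]

/-! ### The weak-star topology of `B(H, K)` -/

/-- The weak-star (ultraweak) topology of `B(H, K)`: the coarsest topology for which all the
functionals `T ↦ ∑ₙ ⟪ηₙ, T ξₙ⟫`, with `∑ₙ ‖ξₙ‖² < ∞` and `∑ₙ ‖ηₙ‖² < ∞`, are continuous. These
functionals are exactly the elements of the predual of `B(H, K)`. -/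
@[reducible] def weakStar (H : Type u) [NormedAddCommGroup H] [InnerProductSpace ℂ H]
    (K : Type v) [NormedAddCommGroup K] [InnerProductSpace ℂ K] :
    TopologicalSpace (H →L[ℂ] K) :=
  ⨅ (ξ : ℕ → H) (η : ℕ → K) (_ : Summable fun n => ‖ξ n‖ ^ 2) (_ : Summable fun n => ‖η n‖ ^ 2),
    TopologicalSpace.induced (fun T : H →L[ℂ] K => ∑' n, ⟪η n, T (ξ n)⟫_ℂ) inferInstance

/-- `[S]^{-w*}`: the weak-star closure of the linear span of `S`. -/
def wspan (S : Set (H →L[ℂ] K)) : Set (H →L[ℂ] K) :=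
  @closure _ (weakStar H K) (Submodule.span ℂ S : Set (H →L[ℂ] K))

/-! ### Operator algebras and their corners -/

/-- A unital dual operator algebra, realized as a weak-star closed subalgebra of `B(H)` which has
a unit. The unit is a projection, possibly different from the identity operator of `H`. -/
def IsUnitalDual [CompleteSpace H] (A : NonUnitalSubalgebra ℂ (H →L[ℂ] H)) : Prop :=
  IsClosed[weakStar H H] (A : Set (H →L[ℂ] H)) ∧
    ∃ e ∈ A, IsStarProjection e ∧ ∀ a ∈ A, e * a = a ∧ a * e = a

/-- The algebra `A` is self-adjoint: `A* = A`. -/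
def IsSelfAdj [CompleteSpace H] (A : NonUnitalSubalgebra ℂ (H →L[ℂ] H)) : Prop :=
  ∀ a ∈ A, star a ∈ A

/-- The corner `pAp = {pap : a ∈ A}`, for a projection `p ∈ A`. -/
def corner [CompleteSpace H] (A : NonUnitalSubalgebra ℂ (H →L[ℂ] H)) (p : H →L[ℂ] H)
    (hp : IsStarProjection p) (hpA : p ∈ A) : NonUnitalSubalgebra ℂ (H →L[ℂ] H) where
  carrier := {x | ∃ a ∈ A, x = p * a * p}
  zero_mem' := ⟨0, A.zero_mem, by simp⟩
  add_mem' := by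
    rintro _ _ ⟨a, ha, rfl⟩ ⟨b, hb, rfl⟩
    exact ⟨a + b, A.add_mem ha hb, by rw [mul_add, add_mul]⟩
  mul_mem' := by
    rintro _ _ ⟨a, ha, rfl⟩ ⟨b, hb, rfl⟩
    refine ⟨a * p * b, A.mul_mem (A.mul_mem ha hpA) hb, ?_⟩
    have h : p * p = p := hp.isIdempotentElem
    calc p * a * p * (p * b * p) = p * a * (p * p) * b * p := by simp only [mul_assoc]
      _ = p * (a * p * b) * p := by rw [h]; simp only [mul_assoc]
  smul_mem' := by
    rintro c _ ⟨a, ha, rfl⟩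
    exact ⟨c • a, A.smul_mem' c ha, by rw [mul_smul_comm, smul_mul_assoc]⟩

/-! ### Ternary rings of operators and TRO-equivalence -/

/-- A ternary ring of operators: a subspace `M` of `B(H, K)` with `M M* M ⊆ M`. -/
def IsTRO [CompleteSpace H] [CompleteSpace K] (M : Submodule ℂ (H →L[ℂ] K)) : Prop :=
  ∀ m₁ ∈ M, ∀ m₂ ∈ M, ∀ m₃ ∈ M, m₁ ∘L (ContinuousLinearMap.adjoint m₂) ∘L m₃ ∈ M

/-- `A ∼_TRO B`: there is a TRO `M ⊆ B(H, K)` with `A = [M* B M]^{-w*}` and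
`B = [M A M*]^{-w*}`. -/
def TROEquiv [CompleteSpace H] [CompleteSpace K] (A : NonUnitalSubalgebra ℂ (H →L[ℂ] H))
    (B : NonUnitalSubalgebra ℂ (K →L[ℂ] K)) : Prop :=
  ∃ M : Submodule ℂ (H →L[ℂ] K), IsTRO M ∧
    (A : Set (H →L[ℂ] H)) =
      wspan {x | ∃ m ∈ M, ∃ b ∈ B, ∃ n ∈ M, x = (ContinuousLinearMap.adjoint m) ∘L b ∘L n} ∧
    (B : Set (K →L[ℂ] K)) =
      wspan {x | ∃ m ∈ M, ∃ a ∈ A, ∃ n ∈ M, x = m ∘L a ∘L (ContinuousLinearMap.adjoint n)}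

/-- `B ⊂_TRO A`: there is a projection `p ∈ A` with `B ∼_TRO pAp`. -/
def TROEmbeds [CompleteSpace H] [CompleteSpace K] (B : NonUnitalSubalgebra ℂ (K →L[ℂ] K))
    (A : NonUnitalSubalgebra ℂ (H →L[ℂ] H)) : Prop :=
  ∃ (p : H →L[ℂ] H) (hp : IsStarProjection p) (hpA : p ∈ A), TROEquiv B (corner A p hp hpA)

/-! ### Completely isometric normal homomorphisms -/

/-- The operator from `Hⁿ` to `Hⁿ` (the Hilbert space direct sum of `n` copies of `H`) given by
an `n × n` matrix of operators. -/
def matrixOp {n : ℕ} (X : Matrix (Fin n) (Fin n) (H →L[ℂ] H)) :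
    PiLp 2 (fun _ : Fin n => H) →L[ℂ] PiLp 2 (fun _ : Fin n => H) :=
  ((PiLp.continuousLinearEquiv 2 ℂ (fun _ : Fin n => H)).symm :
      (Fin n → H) →L[ℂ] PiLp 2 (fun _ : Fin n => H)) ∘L
    (ContinuousLinearMap.pi fun i => ∑ j, X i j ∘L ContinuousLinearMap.proj j) ∘L
    (PiLp.continuousLinearEquiv 2 ℂ (fun _ : Fin n => H) :
      PiLp 2 (fun _ : Fin n => H) →L[ℂ] (Fin n → H))

/-- The map `α : A → B(K)` is a complete isometry: all its amplifications
`M_n(A) → M_n(B(K))` are isometric. -/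
def IsCompletelyIsometric {A : NonUnitalSubalgebra ℂ (H →L[ℂ] H)}
    (α : A →ₙₐ[ℂ] (K →L[ℂ] K)) : Prop :=
  ∀ (n : ℕ) (X : Matrix (Fin n) (Fin n) A),
    ‖matrixOp (X.map fun x => α x)‖ = ‖matrixOp (X.map fun x => (x : H →L[ℂ] H))‖

/-- The homomorphism `α : A → B(K)` is weak-star continuous and completely isometric. -/
def IsNormalCI {A : NonUnitalSubalgebra ℂ (H →L[ℂ] H)}
    (α : A →ₙₐ[ℂ] (K →L[ℂ] K)) : Prop :=
  Continuous[(weakStar H H).induced Subtype.val, weakStar K K] α ∧ IsCompletelyIsometric α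

/-! ### Delta-equivalence and Delta-embedding -/

/-- `A ∼_Δ B`: there are weak-star continuous completely isometric homomorphisms `α` of `A` and
`β` of `B`, on Hilbert spaces `H'` and `K'`, with `α(A) ∼_TRO β(B)`. -/
def DeltaEquiv (A : NonUnitalSubalgebra ℂ (H →L[ℂ] H))
    (B : NonUnitalSubalgebra ℂ (K →L[ℂ] K)) : Prop :=
  ∃ (H' : Type w) (_ : NormedAddCommGroup H') (_ : InnerProductSpace ℂ H') (_ : CompleteSpace H')
    (K' : Type w) (_ : NormedAddCommGroup K') (_ : InnerProductSpace ℂ K') (_ : CompleteSpace K')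
    (α : A →ₙₐ[ℂ] (H' →L[ℂ] H')) (β : B →ₙₐ[ℂ] (K' →L[ℂ] K')),
    IsNormalCI α ∧ IsNormalCI β ∧ TROEquiv (NonUnitalAlgHom.range α) (NonUnitalAlgHom.range β)

/-- `B ⊂_Δ A`: there are weak-star continuous completely isometric homomorphisms `α` of `A` and
`β` of `B`, on Hilbert spaces `H'` and `K'`, with `β(B) ⊂_TRO α(A)`. -/
def DeltaEmbeds (B : NonUnitalSubalgebra ℂ (K →L[ℂ] K))
    (A : NonUnitalSubalgebra ℂ (H →L[ℂ] H)) : Prop :=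
  ∃ (H' : Type w) (_ : NormedAddCommGroup H') (_ : InnerProductSpace ℂ H') (_ : CompleteSpace H')
    (K' : Type w) (_ : NormedAddCommGroup K') (_ : InnerProductSpace ℂ K') (_ : CompleteSpace K')
    (α : A →ₙₐ[ℂ] (H' →L[ℂ] H')) (β : B →ₙₐ[ℂ] (K' →L[ℂ] K')),
    IsNormalCI α ∧ IsNormalCI β ∧ TROEmbeds (NonUnitalAlgHom.range β) (NonUnitalAlgHom.range α)

/-! ### Nests and nest algebras -/

/-- A nest: a set of projections of `B(H)` that contains `0` and `1`, is totally ordered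
(projections are ordered by inclusion of their ranges), and contains the supremum (the projection
onto the closed linear span of the ranges) and the infimum (the projection onto the intersection
of the ranges) of each of its subsets. -/
def IsNest [CompleteSpace H] (N : Set (H →L[ℂ] H)) : Prop :=
  (∀ l ∈ N, IsStarProjection l) ∧ 0 ∈ N ∧ 1 ∈ N ∧
    (∀ k ∈ N, ∀ l ∈ N, k.range ≤ l.range ∨ l.range ≤ k.range) ∧
    ∀ S ⊆ N, (∃ l ∈ N, l.range = (⨆ k ∈ S, k.range).topologicalClosure) ∧
      ∃ l ∈ N, l.range = ⨅ k ∈ S, k.range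

/-- `Alg(N)`: the operators `x` with `l^⊥ x l = 0` for all `l ∈ N`. -/
def Alg (N : Set (H →L[ℂ] H)) : NonUnitalSubalgebra ℂ (H →L[ℂ] H) where
  carrier := {x | ∀ l ∈ N, (1 - l) * x * l = 0}
  zero_mem' := fun l _ => by simp
  add_mem' := fun {x y} hx hy l hl => by
    rw [mul_add, add_mul, hx l hl, hy l hl, add_zero]
  mul_mem' := fun {x y} hx hy l hl => by
    have h : y * l = l * y * l := by
      have := hy l hl
      rwa [sub_mul, sub_mul, one_mul, sub_eq_zero] at this
    calc (1 - l) * (x * y) * l = (1 - l) * x * (y * l) := by simp only [mul_assoc]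
      _ = (1 - l) * x * (l * y * l) := by rw [← h]
      _ = ((1 - l) * x * l) * (y * l) := by simp only [mul_assoc]
      _ = 0 := by rw [hx l hl, zero_mul]
  smul_mem' := fun c x hx l hl => by
    rw [mul_smul_comm, smul_mul_assoc, hx l hl, smul_zero]

end General

/-! ### The nest on `ℓ²(ℚ ∩ [0,1]) ⊕ L²[0,1]` -/

/-- The set `ℚ ∩ [0,1]`. -/
abbrev RatUnit : Type := {r : ℚ // 0 ≤ r ∧ r ≤ 1}

/-- Lebesgue measure on `[0,1]`. -/
abbrev leb : Measure ℝ := volume.restrict (Set.Icc (0 : ℝ) 1)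

/-- The Hilbert space `ℓ²(ℚ ∩ [0,1]) ⊕ L²[0,1]`. -/
abbrev Hsp : Type := WithLp 2 (lp (fun _ : RatUnit => ℂ) 2 × Lp ℂ 2 leb)

/-- The subspace `ℓ²(D) ⊕ L²(E)` of `ℓ²(ℚ ∩ [0,1]) ⊕ L²[0,1]`, formed by the pairs `(ξ, f)` such
that `ξ` vanishes off `D` and `f` vanishes almost everywhere off `E`. -/
def cutSpace (D : Set ℚ) (E : Set ℝ) : Submodule ℂ Hsp where
  carrier := {x | (∀ r : RatUnit, (r : ℚ) ∉ D → x.fst r = 0) ∧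
    ∀ᵐ s ∂leb, s ∉ E → x.snd s = 0}
  zero_mem' := by
    refine ⟨fun r _ => rfl, ?_⟩
    filter_upwards [Lp.coeFn_zero ℂ 2 leb] with s hs _
    simpa using hs
  add_mem' := by
    rintro x y ⟨hx, hx'⟩ ⟨hy, hy'⟩
    refine ⟨fun r hr => ?_, ?_⟩
    · simp [hx r hr, hy r hr]
    · filter_upwards [hx', hy', Lp.coeFn_add x.snd y.snd] with s h1 h2 h3 hs
      rw [WithLp.add_snd, h3, Pi.add_apply, h1 hs, h2 hs, add_zero]
  smul_mem' := by
    rintro c x ⟨hx, hx'⟩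
    refine ⟨fun r hr => ?_, ?_⟩
    · simp [hx r hr]
    · filter_upwards [hx', Lp.coeFn_smul c x.snd] with s h1 h3 hs
      rw [WithLp.smul_snd, h3, Pi.smul_apply, h1 hs, smul_zero]

theorem isClosed_cutSpace (D : Set ℚ) (E : Set ℝ) :
    IsClosed (cutSpace D E : Set Hsp) := by
  have h1 : IsClosed {x : Hsp | ∀ r : RatUnit, (r : ℚ) ∉ D → x.fst r = 0} := by
    simp only [Set.ofPred_forall]
    refine isClosed_iInter fun r => isClosed_iInter fun _ => ?_
    have hc : Continuous fun x : Hsp => x.fst r :=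
      (lp.lipschitzWith_one_eval 2 r).continuous.comp (WithLp.continuous_fst 2 _ _)
    exact isClosed_eq hc continuous_const
  have h2 : IsClosed {f : Lp ℂ 2 leb | ∀ᵐ s ∂leb, s ∉ E → f s = 0} := by
    refine IsSeqClosed.isClosed fun f g hf hfg => ?_
    obtain ⟨φ, -, hφ⟩ := (tendstoInMeasure_of_tendsto_Lp hfg).exists_seq_tendsto_ae
    have hall : ∀ᵐ s ∂leb, ∀ n, s ∉ E → f n s = 0 := ae_all_iff.2 hf
    change ∀ᵐ s ∂leb, s ∉ E → g s = 0
    filter_upwards [hφ, hall] with s hs hz hsE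
    refine tendsto_nhds_unique hs ?_
    simp [hz _ hsE]
  exact h1.inter (h2.preimage (WithLp.continuous_snd 2 _ _))

instance (D : Set ℚ) (E : Set ℝ) : CompleteSpace (cutSpace D E) :=
  (isClosed_cutSpace D E).completeSpace_coe

/-- The orthogonal projection of `ℓ²(ℚ ∩ [0,1]) ⊕ L²[0,1]` onto `ℓ²(D) ⊕ L²(E)`. -/
def cutProj (D : Set ℚ) (E : Set ℝ) : Hsp →L[ℂ] Hsp :=
  (cutSpace D E).starProjection

/-- `Q⁺_t ⊕ N_t`, the projection onto `ℓ²(ℚ ∩ [0,t]) ⊕ L²[0,t]`. -/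
def nestPlus (t : ℝ) : Hsp →L[ℂ] Hsp := cutProj {r | 0 ≤ r ∧ (r : ℝ) ≤ t} (Set.Icc 0 t)

/-- `Q⁻_t ⊕ N_t`, the projection onto `ℓ²(ℚ ∩ [0,t)) ⊕ L²[0,t]`. -/
def nestMinus (t : ℝ) : Hsp →L[ℂ] Hsp := cutProj {r | 0 ≤ r ∧ (r : ℝ) < t} (Set.Icc 0 t)

/-- The nest `{Q⁺_t ⊕ N_t, Q⁻_t ⊕ N_t : 0 ≤ t ≤ 1}`. -/
def theNest : Set (Hsp →L[ℂ] Hsp) :=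
  {l | ∃ t ∈ Set.Icc (0 : ℝ) 1, l = nestPlus t ∨ l = nestMinus t}

/-- The projection `q` onto `ℓ²(ℚ ∩ [0,1/2]) ⊕ L²[0,1]`. -/
def qProj : Hsp →L[ℂ] Hsp := cutProj {r | 0 ≤ r ∧ r ≤ 1 / 2} (Set.Icc 0 1)

end

end DeltaEmb

/-! The invariant is the poset of left annihilators {x : xJ = 0}, with J closed under left
multiplication. If a TRO M implements A ∼ B, then I ↦ {b : M*bM ⊆ I} is an order isomorphism of
these posets (`Implements.nonempty_orderIso`). Complete isometries are injective, so ∼_Δ preserves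
the poset as well (`DeltaEquiv.nonempty_orderIso`).

In a corner qAq of a nest algebra, the closed span of AJH is A-invariant, hence is the range of some
l in the nest (`IsNest.exists_range_eq`), and the annihilator of J is {x : xl = 0}
(`IsCorner.exists_eq_annih`). The poset is therefore the compressed nest {lq} with its order
reversed. For q = 1 every rational r gives a gap between Q⁻_r ⊕ N_r and Q⁺_r ⊕ N_r, so a covering
pair sits between any two comparable elements (`hasDenseCovers_alg`). The projection q of the
theorem removes the atoms beyond 1/2 and leaves a continuous stretch without covers
(`not_hasDenseCovers`). Hence A and qAq are not equivalent.

For the embeddings, qAq sits in A through q itself. The dilation s ↦ s/2 induces an isometry V with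
range below Q⁺_{1/2} ⊕ N_{1/2} ≤ q that carries the nest to its lower half, so VAV* is the corner of
qAq at VV* (`deltaEmbeds_corner`). -/

namespace DeltaEmb

noncomputable section

/-! ### Weak-star continuity and closedness -/

section WeakStar

variable {H : Type*} [NormedAddCommGroup H] [InnerProductSpace ℂ H]
variable {K : Type*} [NormedAddCommGroup K] [InnerProductSpace ℂ K]
variable {H' : Type*} [NormedAddCommGroup H'] [InnerProductSpace ℂ H']
variable {K' : Type*} [NormedAddCommGroup K'] [InnerProductSpace ℂ K']

theorem continuous_weakStar_tsum (ξ : ℕ → H) (η : ℕ → K)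
    (hξ : Summable fun n => ‖ξ n‖ ^ 2) (hη : Summable fun n => ‖η n‖ ^ 2) :
    Continuous[weakStar H K, inferInstance] fun T : H →L[ℂ] K => ∑' n, ⟪η n, T (ξ n)⟫_ℂ :=
  continuous_iInf_dom (continuous_iInf_dom (continuous_iInf_dom (i := hξ)
    (continuous_iInf_dom (i := hη) continuous_induced_dom)))

theorem continuous_weakStar_inner (ξ : H) (η : K) :
    Continuous[weakStar H K, inferInstance] fun T : H →L[ℂ] K => ⟪η, T ξ⟫_ℂ := by
  have h := continuous_weakStar_tsum (K := K) (fun n : ℕ => if n = 0 then ξ else 0)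
    (fun n : ℕ => if n = 0 then η else 0)
    (summable_of_ne_finset_zero (s := {0}) (by intro n hn; simp_all))
    (summable_of_ne_finset_zero (s := {0}) (by intro n hn; simp_all))
  convert h using 2 with T
  rw [tsum_eq_single 0 (by intro n hn; simp [hn])]
  simp

theorem summable_norm_sq_clm (a : H →L[ℂ] K) {ξ : ℕ → H} (hξ : Summable fun n => ‖ξ n‖ ^ 2) :
    Summable fun n => ‖a (ξ n)‖ ^ 2 := by
  refine Summable.of_nonneg_of_le (fun n => sq_nonneg _) (fun n => ?_) (hξ.mul_left (‖a‖ ^ 2))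
  rw [← mul_pow]
  exact pow_le_pow_left₀ (norm_nonneg _) (a.le_opNorm _) 2

/-- Multiplication on both sides by fixed operators is weak-star continuous. -/
theorem continuous_weakStar_comp [CompleteSpace K] [CompleteSpace K'] (a : K →L[ℂ] K')
    (b : H' →L[ℂ] H) :
    Continuous[weakStar H K, weakStar H' K'] fun T : H →L[ℂ] K => a ∘L T ∘L b := by
  refine continuous_iInf_rng.2 fun ξ => continuous_iInf_rng.2 fun η =>
    continuous_iInf_rng.2 fun hξ => continuous_iInf_rng.2 fun hη => continuous_induced_rng.2 ?_
  have h := continuous_weakStar_tsum (fun n => b (ξ n)) (fun n => ContinuousLinearMap.adjoint a (η n))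
    (summable_norm_sq_clm b hξ) (summable_norm_sq_clm (ContinuousLinearMap.adjoint a) hη)
  convert h using 2 with T
  simp [ContinuousLinearMap.adjoint_inner_left]

/-- Tested on vectors, the equation says that the continuous functionals T ↦ ⟪a*η, T(bξ)⟫ all
vanish. -/
theorem isClosed_weakStar_setOf_comp_eq_zero (a : K →L[ℂ] K') (b : H' →L[ℂ] H)
    [CompleteSpace K] [CompleteSpace K'] :
    IsClosed[weakStar H K] {T : H →L[ℂ] K | a ∘L T ∘L b = 0} := by
  have h : {T : H →L[ℂ] K | a ∘L T ∘L b = 0} =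
      ⋂ (ξ : H') (η : K'), {T : H →L[ℂ] K | ⟪ContinuousLinearMap.adjoint a η, T (b ξ)⟫_ℂ = 0} := by
    ext T
    simp only [Set.mem_ofPred_eq, Set.mem_iInter, ContinuousLinearMap.adjoint_inner_left]
    constructor
    · intro h ξ η
      have := congrArg (fun S : H' →L[ℂ] K' => S ξ) h
      simp only [ContinuousLinearMap.comp_apply, zero_apply] at this
      simp [this]
    · intro h
      ext ξ
      simpa using h ξ (a (T (b ξ)))
  rw [h]
  let := weakStar H K
  exact isClosed_iInter fun ξ => isClosed_iInter fun η =>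
    isClosed_eq (continuous_weakStar_inner _ _) continuous_const

theorem subset_wspan (S : Set (H →L[ℂ] K)) : S ⊆ wspan S := by
  let := weakStar H K
  exact Submodule.subset_span.trans subset_closure

theorem isClosed_wspan (S : Set (H →L[ℂ] K)) : IsClosed[weakStar H K] (wspan S) := by
  let := weakStar H K
  exact isClosed_closure

theorem wspan_subset {S : Set (H →L[ℂ] K)} (F : Submodule ℂ (H →L[ℂ] K))
    (hF : IsClosed[weakStar H K] (F : Set (H →L[ℂ] K))) (h : S ⊆ F) :
    wspan S ⊆ F := by
  let := weakStar H K
  exact closure_minimal (Submodule.span_le.2 h) hF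

theorem wspan_eq_self (F : Submodule ℂ (H →L[ℂ] K))
    (hF : IsClosed[weakStar H K] (F : Set (H →L[ℂ] K))) :
    wspan (F : Set (H →L[ℂ] K)) = F :=
  (wspan_subset F hF subset_rfl).antisymm (subset_wspan _)

/-- The operators `T` with `a T b = 0`, as a subspace. -/
def annihilated (a : K →L[ℂ] K') (b : H' →L[ℂ] H) : Submodule ℂ (H →L[ℂ] K) where
  carrier := {T | a ∘L T ∘L b = 0}
  zero_mem' := by simp
  add_mem' := by
    intro S T hS hT
    simp only [Set.mem_ofPred_eq] at *
    rw [ContinuousLinearMap.add_comp, ContinuousLinearMap.comp_add, hS, hT, add_zero]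
  smul_mem' := by
    intro c T hT
    simp only [Set.mem_ofPred_eq] at *
    rw [ContinuousLinearMap.smul_comp, ContinuousLinearMap.comp_smul, hT, smul_zero]

/-- This and the next lemma are the induction principles for `wspan`: two-sided multiplication is
linear and weak-star continuous, so a closed linear condition need only be checked on generators. -/
theorem comp_eq_zero_of_mem_wspan [CompleteSpace K] [CompleteSpace K'] {S : Set (H →L[ℂ] K)}
    {T : H →L[ℂ] K} (hT : T ∈ wspan S) (a : K →L[ℂ] K') (b : H' →L[ℂ] H)
    (h : ∀ s ∈ S, a ∘L s ∘L b = 0) : a ∘L T ∘L b = 0 :=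
  wspan_subset (annihilated a b) (isClosed_weakStar_setOf_comp_eq_zero a b) h hT

theorem comp_mem_of_mem_wspan [CompleteSpace K] [CompleteSpace K'] {S : Set (H →L[ℂ] K)}
    {T : H →L[ℂ] K} (hT : T ∈ wspan S) (a : K →L[ℂ] K') (b : H' →L[ℂ] H)
    (F : Submodule ℂ (H' →L[ℂ] K')) (hF : IsClosed[weakStar H' K'] (F : Set (H' →L[ℂ] K')))
    (h : ∀ s ∈ S, a ∘L s ∘L b ∈ F) : a ∘L T ∘L b ∈ F := by
  let f : (H →L[ℂ] K) →ₗ[ℂ] (H' →L[ℂ] K') :=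
    { toFun := fun T => a ∘L T ∘L b
      map_add' := fun S T => by rw [ContinuousLinearMap.add_comp, ContinuousLinearMap.comp_add]
      map_smul' := fun c T => by
        rw [ContinuousLinearMap.smul_comp, ContinuousLinearMap.comp_smul]; rfl }
  have hcl : IsClosed[weakStar H K] ((F.comap f : Submodule ℂ _) : Set (H →L[ℂ] K)) :=
    @IsClosed.preimage _ _ (weakStar H K) (weakStar H' K') _ (continuous_weakStar_comp a b) _ hF
  exact wspan_subset (F.comap f) hcl h hT

/-- Because p ∈ A, the corner is cut out of A by the closed equations (1 - p)x = 0 and x(1 - p) = 0.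
-/
theorem isClosed_corner [CompleteSpace H] {A : NonUnitalSubalgebra ℂ (H →L[ℂ] H)}
    (hA : IsClosed[weakStar H H] (A : Set (H →L[ℂ] H))) (p : H →L[ℂ] H)
    (hp : IsStarProjection p) (hpA : p ∈ A) :
    IsClosed[weakStar H H] (corner A p hp hpA : Set (H →L[ℂ] H)) := by
  have h : (corner A p hp hpA : Set (H →L[ℂ] H)) =
      (A : Set (H →L[ℂ] H)) ∩ ({x | (1 - p) ∘L x ∘L (1 : H →L[ℂ] H) = 0} ∩ {x | (1 : H →L[ℂ] H) ∘L x ∘L (1 - p) = 0}) := by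
    have hpp : p * p = p := hp.isIdempotentElem
    ext x
    constructor
    · rintro ⟨a, ha, rfl⟩
      refine ⟨A.mul_mem (A.mul_mem hpA ha) hpA, ?_, ?_⟩
      · change (1 - p) * ((p * a * p) * 1) = 0
        rw [mul_one, ← mul_assoc, ← mul_assoc, sub_mul, one_mul, hpp, sub_self, zero_mul, zero_mul]
      · change 1 * ((p * a * p) * (1 - p)) = 0
        rw [one_mul, mul_assoc, mul_sub, mul_one, hpp, sub_self, mul_zero]
    · rintro ⟨hx, h1, h2⟩
      change (1 - p) * (x * 1) = 0 at h1
      change 1 * (x * (1 - p)) = 0 at h2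
      rw [mul_one, sub_mul, one_mul, sub_eq_zero] at h1
      rw [one_mul, mul_sub, mul_one, sub_eq_zero] at h2
      exact ⟨x, hx, by rw [← h1, ← h2]⟩
  rw [h]
  let := weakStar H H
  exact hA.inter ((isClosed_weakStar_setOf_comp_eq_zero _ _).inter
    (isClosed_weakStar_setOf_comp_eq_zero _ _))

theorem isUnitalDual_corner [CompleteSpace H] {A : NonUnitalSubalgebra ℂ (H →L[ℂ] H)}
    (hA : IsClosed[weakStar H H] (A : Set (H →L[ℂ] H))) (p : H →L[ℂ] H)
    (hp : IsStarProjection p) (hpA : p ∈ A) : IsUnitalDual (corner A p hp hpA) := by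
  have hpp : p * p = p := hp.isIdempotentElem
  refine ⟨isClosed_corner hA p hp hpA, p, ⟨p, hpA, by rw [hpp, hpp]⟩, hp, ?_⟩
  rintro _ ⟨a, -, rfl⟩
  exact ⟨by rw [← mul_assoc, ← mul_assoc, hpp], by rw [mul_assoc, hpp]⟩

theorem isClosed_alg [CompleteSpace H] (N : Set (H →L[ℂ] H)) :
    IsClosed[weakStar H H] (Alg N : Set (H →L[ℂ] H)) := by
  have h : (Alg N : Set (H →L[ℂ] H)) = ⋂ l ∈ N, {x | (1 - l) ∘L x ∘L l = 0} := by
    ext x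
    simp only [Set.mem_iInter]
    rfl
  rw [h]
  let := weakStar H H
  exact isClosed_biInter fun l _ => isClosed_weakStar_setOf_comp_eq_zero _ _

end WeakStar

/-! ### Equivalences and embeddings implemented by one partial isometry -/

section PartialIsometry

variable {H : Type*} [NormedAddCommGroup H] [InnerProductSpace ℂ H] [CompleteSpace H]
variable {K : Type*} [NormedAddCommGroup K] [InnerProductSpace ℂ K] [CompleteSpace K]

omit [CompleteSpace H] in
theorem wspan_eq_of_eq_set {S : Set (H →L[ℂ] H)} {A : NonUnitalSubalgebra ℂ (H →L[ℂ] H)}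
    (hA : IsClosed[weakStar H H] (A : Set (H →L[ℂ] H))) (h : S = A) :
    (A : Set (H →L[ℂ] H)) = wspan S := by
  rw [h]
  exact (wspan_eq_self A.toSubmodule hA).symm

/-- Algebras implemented onto each other by a partial isometry are TRO-equivalent. -/
theorem TROEquiv.of_partialIsometry {A : NonUnitalSubalgebra ℂ (H →L[ℂ] H)}
    {B : NonUnitalSubalgebra ℂ (K →L[ℂ] K)} (hA : IsClosed[weakStar H H] (A : Set (H →L[ℂ] H)))
    (hB : IsClosed[weakStar K K] (B : Set (K →L[ℂ] K))) (U : H →L[ℂ] K) (U' : K →L[ℂ] H)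
    (hU' : ContinuousLinearMap.adjoint U = U')
    (hU : U ∘L U' ∘L U = U)
    (h1 : ∀ a ∈ A, U ∘L a ∘L U' ∈ B) (h2 : ∀ a ∈ A, U' ∘L (U ∘L a ∘L U') ∘L U = a)
    (h3 : ∀ b ∈ B, U' ∘L b ∘L U ∈ A) (h4 : ∀ b ∈ B, U ∘L (U' ∘L b ∘L U) ∘L U' = b) :
    TROEquiv A B := by
  -- The TRO is the line ℂU; U U* U = U makes it ternary. The products U*BU and UAU* already fill
  -- the closed algebras, so taking `wspan` adds nothing.
  refine ⟨Submodule.span ℂ {U}, ?_, wspan_eq_of_eq_set hA ?_, wspan_eq_of_eq_set hB ?_⟩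
  · intro m₁ h₁ m₂ h₂ m₃ h₃
    obtain ⟨c₁, rfl⟩ := Submodule.mem_span_singleton.1 h₁
    obtain ⟨c₂, rfl⟩ := Submodule.mem_span_singleton.1 h₂
    obtain ⟨c₃, rfl⟩ := Submodule.mem_span_singleton.1 h₃
    refine Submodule.mem_span_singleton.2 ⟨c₁ * starRingEnd ℂ c₂ * c₃, ?_⟩
    simp only [map_smulₛₗ, hU', ContinuousLinearMap.smul_comp, ContinuousLinearMap.comp_smul, hU,
      smul_smul]
    congr 1
    ring
  · ext x
    constructor
    · rintro ⟨m, hm, b, hb, n, hn, rfl⟩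
      obtain ⟨c, rfl⟩ := Submodule.mem_span_singleton.1 hm
      obtain ⟨d, rfl⟩ := Submodule.mem_span_singleton.1 hn
      simp only [map_smulₛₗ, hU', ContinuousLinearMap.smul_comp, ContinuousLinearMap.comp_smul]
      exact A.smul_mem' _ (A.smul_mem' _ (h3 b hb))
    · intro hx
      exact ⟨U, Submodule.mem_span_singleton_self U, _, h1 x hx, U,
        Submodule.mem_span_singleton_self U, by rw [hU', h2 x hx]⟩
  · ext x
    constructor
    · rintro ⟨m, hm, b, hb, n, hn, rfl⟩
      obtain ⟨c, rfl⟩ := Submodule.mem_span_singleton.1 hm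
      obtain ⟨d, rfl⟩ := Submodule.mem_span_singleton.1 hn
      simp only [map_smulₛₗ, hU', ContinuousLinearMap.smul_comp, ContinuousLinearMap.comp_smul]
      exact B.smul_mem' _ (B.smul_mem' _ (h1 b hb))
    · intro hx
      exact ⟨U, Submodule.mem_span_singleton_self U, _, h3 x hx, U,
        Submodule.mem_span_singleton_self U, by rw [hU', h4 x hx]⟩

/-- The homomorphism `a ↦ V a V*` of `A`, for a unitary `V`. -/
def conjHom (V : H ≃ₗᵢ[ℂ] K) (A : NonUnitalSubalgebra ℂ (H →L[ℂ] H)) : A →ₙₐ[ℂ] (K →L[ℂ] K) where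
  toFun a := (V : H →L[ℂ] K) ∘L (a : H →L[ℂ] H) ∘L (V.symm : K →L[ℂ] H)
  map_smul' c a := by ext; simp
  map_zero' := by ext; simp
  map_add' a b := by ext; simp
  map_mul' a b := by ext; simp

omit [CompleteSpace H] [CompleteSpace K] in
theorem conjHom_apply (V : H ≃ₗᵢ[ℂ] K) (A : NonUnitalSubalgebra ℂ (H →L[ℂ] H)) (a : A) (x : K) :
    conjHom V A a x = V ((a : H →L[ℂ] H) (V.symm x)) := rfl

omit [CompleteSpace H] [CompleteSpace K] in
theorem mem_range_conjHom {V : H ≃ₗᵢ[ℂ] K} {A : NonUnitalSubalgebra ℂ (H →L[ℂ] H)}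
    {T : K →L[ℂ] K} : T ∈ NonUnitalAlgHom.range (conjHom V A) ↔
      ∃ a ∈ A, (V : H →L[ℂ] K) ∘L a ∘L (V.symm : K →L[ℂ] H) = T :=
  ⟨fun ⟨a, h⟩ => ⟨a, a.2, h⟩, fun ⟨a, ha, h⟩ => ⟨⟨a, ha⟩, h⟩⟩

/-- Each amplification of the conjugation is conjugation by the diagonal unitary V ⊕ ⋯ ⊕ V, hence
isometric. -/
theorem conjHom_isNormalCI (V : H ≃ₗᵢ[ℂ] K) (A : NonUnitalSubalgebra ℂ (H →L[ℂ] H)) :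
    IsNormalCI (conjHom V A) := by
  constructor
  · exact @Continuous.comp _ _ _ ((weakStar H H).induced Subtype.val) (weakStar H H) (weakStar K K)
      _ _ (continuous_weakStar_comp (V : H →L[ℂ] K) (V.symm : K →L[ℂ] H)) continuous_induced_dom
  · intro n X
    let W : PiLp 2 (fun _ : Fin n => H) ≃ₗᵢ[ℂ] PiLp 2 (fun _ : Fin n => K) :=
      LinearIsometryEquiv.piLpCongrRight 2 fun _ => V
    have h : matrixOp (X.map fun x => conjHom V A x) =
        (W.toLinearIsometry.toContinuousLinearMap ∘L matrixOp (X.map fun x => (x : H →L[ℂ] H))) ∘L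
          (W.symm : PiLp 2 (fun _ : Fin n => K) →L[ℂ] PiLp 2 (fun _ : Fin n => H)) := by
      ext x i
      simp [matrixOp, W, conjHom_apply]
    rw [h, ContinuousLinearMap.opNorm_comp_linearIsometryEquiv,
      LinearIsometry.norm_toContinuousLinearMap_comp]

theorem isClosed_range_conjHom (V : H ≃ₗᵢ[ℂ] K) {A : NonUnitalSubalgebra ℂ (H →L[ℂ] H)}
    (hA : IsClosed[weakStar H H] (A : Set (H →L[ℂ] H))) :
    IsClosed[weakStar K K] (NonUnitalAlgHom.range (conjHom V A) : Set (K →L[ℂ] K)) := by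
  have h : (NonUnitalAlgHom.range (conjHom V A) : Set (K →L[ℂ] K)) =
      (fun T : K →L[ℂ] K => (V.symm : K →L[ℂ] H) ∘L T ∘L (V : H →L[ℂ] K)) ⁻¹' A := by
    ext T
    constructor
    · rintro ⟨a, rfl⟩
      have : (V.symm : K →L[ℂ] H) ∘L (conjHom V A a) ∘L (V : H →L[ℂ] K) = a := by
        ext x; simp [conjHom_apply]
      change (V.symm : K →L[ℂ] H) ∘L (conjHom V A a) ∘L (V : H →L[ℂ] K) ∈ A
      rw [this]
      exact a.2
    · intro hT
      refine ⟨⟨_, hT⟩, ?_⟩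
      ext x
      change V (V.symm (T (V (V.symm x)))) = T x
      simp
  rw [h]
  exact @IsClosed.preimage _ _ (weakStar K K) (weakStar H H) _ (continuous_weakStar_comp _ _) _ hA

/-- A Hilbert space is unitarily equivalent to one in a higher universe. -/
def liftEquiv (H : Type u) [NormedAddCommGroup H] [InnerProductSpace ℂ H] :
    H ≃ₗᵢ[ℂ] PiLp 2 (fun _ : PUnit.{w + 1} => H) where
  toLinearEquiv := (PiLp.equivOfUnique 2 ℂ (fun _ : PUnit.{w + 1} => H)).symm.toLinearEquiv
  norm_map' x := by
    rw [PiLp.norm_eq_of_L2]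
    simp [PiLp.equivOfUnique]

theorem isStarProjection_conj (V : H ≃ₗᵢ[ℂ] K) {p : H →L[ℂ] H} (hp : IsStarProjection p) :
    IsStarProjection ((V : H →L[ℂ] K) ∘L p ∘L (V.symm : K →L[ℂ] H)) := by
  constructor
  · have hpp : ∀ x, p (p x) = p x := fun x => DFunLike.congr_fun hp.isIdempotentElem x
    ext x
    simp [hpp]
  · have h : ContinuousLinearMap.adjoint p = p := hp.isSelfAdjoint
    change ContinuousLinearMap.adjoint ((V : H →L[ℂ] K) ∘L p ∘L (V.symm : K →L[ℂ] H)) = _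
    rw [ContinuousLinearMap.adjoint_comp, ContinuousLinearMap.adjoint_comp,
      LinearIsometryEquiv.adjoint_eq_symm, h, LinearIsometryEquiv.adjoint_eq_symm]
    rfl

/-- U identifies B with the corner of A at its range projection p = UU*. After conjugation by the
unitaries V and W the implementing partial isometry is VUW*. -/
theorem TROEmbeds.of_partialIsometry {H' : Type*} [NormedAddCommGroup H'] [InnerProductSpace ℂ H']
    [CompleteSpace H'] {K' : Type*} [NormedAddCommGroup K'] [InnerProductSpace ℂ K']
    [CompleteSpace K'] (V : H ≃ₗᵢ[ℂ] H') (W : K ≃ₗᵢ[ℂ] K')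
    {A : NonUnitalSubalgebra ℂ (H →L[ℂ] H)}
    {B : NonUnitalSubalgebra ℂ (K →L[ℂ] K)} (hA : IsClosed[weakStar H H] (A : Set (H →L[ℂ] H)))
    (hB : IsClosed[weakStar K K] (B : Set (K →L[ℂ] K))) {p : H →L[ℂ] H} (hp : IsStarProjection p)
    (hpA : p ∈ A) (U : K →L[ℂ] H) (U' : H →L[ℂ] K) (hU' : ContinuousLinearMap.adjoint U = U')
    (hU : U ∘L U' = p) (h1 : ∀ b ∈ B, U ∘L b ∘L U' ∈ A)
    (h2 : ∀ b ∈ B, U' ∘L (U ∘L b ∘L U') ∘L U = b) (h3 : ∀ a ∈ A, U' ∘L a ∘L U ∈ B)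
    (h4 : U ∘L U' ∘L U = U) :
    TROEmbeds (NonUnitalAlgHom.range (conjHom W B)) (NonUnitalAlgHom.range (conjHom V A)) := by
  have hpp : ∀ x, p (p x) = p x := fun x => DFunLike.congr_fun hp.isIdempotentElem x
  have hps : ContinuousLinearMap.adjoint p = p := hp.isSelfAdjoint
  have e3 : ∀ x, U (U' x) = p x := fun x => DFunLike.congr_fun hU x
  have e1 : ∀ x, p (U x) = U x := fun x => by
    rw [← e3]
    exact DFunLike.congr_fun h4 x
  have h5 : U' ∘L p = U' := by
    have h : p ∘L U = U := ContinuousLinearMap.ext e1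
    rw [← hU', ← hps, ← ContinuousLinearMap.adjoint_comp, h]
  have e2 : ∀ x, U' (p x) = U' x := fun x => DFunLike.congr_fun h5 x
  have hqA : (V : H →L[ℂ] H') ∘L p ∘L (V.symm : H' →L[ℂ] H) ∈ NonUnitalAlgHom.range (conjHom V A) :=
    ⟨⟨p, hpA⟩, rfl⟩
  refine ⟨_, isStarProjection_conj V hp, hqA, ?_⟩
  refine TROEquiv.of_partialIsometry (isClosed_range_conjHom W hB)
    (isClosed_corner (isClosed_range_conjHom V hA) _ (isStarProjection_conj V hp) hqA)
    ((V : H →L[ℂ] H') ∘L U ∘L (W.symm : K' →L[ℂ] K))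
    ((W : K →L[ℂ] K') ∘L U' ∘L (V.symm : H' →L[ℂ] H)) ?_ ?_ ?_ ?_ ?_ ?_
  · rw [ContinuousLinearMap.adjoint_comp, ContinuousLinearMap.adjoint_comp,
      LinearIsometryEquiv.adjoint_eq_symm, LinearIsometryEquiv.adjoint_eq_symm, hU']
    rfl
  · ext1 x
    simp [e3, e1]
  · intro _ hb
    obtain ⟨b, hb', rfl⟩ := mem_range_conjHom.1 hb
    refine ⟨_, mem_range_conjHom.2 ⟨_, h1 b hb', rfl⟩, ?_⟩
    ext1 x
    simp [e1, e2]
  · intro _ hb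
    obtain ⟨b, hb', rfl⟩ := mem_range_conjHom.1 hb
    ext1 x
    have := DFunLike.congr_fun (h2 b hb') (W.symm x)
    simp only [ContinuousLinearMap.comp_apply] at this
    simp [this]
  · rintro _ ⟨_, ha, rfl⟩
    obtain ⟨a, ha', rfl⟩ := mem_range_conjHom.1 ha
    refine mem_range_conjHom.2 ⟨_, h3 a ha', ?_⟩
    ext1 x
    simp [e1, e2]
  · rintro _ ⟨_, ha, rfl⟩
    obtain ⟨a, ha', rfl⟩ := mem_range_conjHom.1 ha
    ext1 x
    simp [hpp, e3, e2]

/-- The representing Hilbert spaces of a Delta-embedding live in universe `w`, so both algebras are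
first moved there by `liftEquiv`; no other change of representation is needed. -/
theorem DeltaEmbeds.of_partialIsometry {H K : Type} [NormedAddCommGroup H] [InnerProductSpace ℂ H]
    [CompleteSpace H] [NormedAddCommGroup K] [InnerProductSpace ℂ K] [CompleteSpace K]
    {A : NonUnitalSubalgebra ℂ (H →L[ℂ] H)}
    {B : NonUnitalSubalgebra ℂ (K →L[ℂ] K)} (hA : IsClosed[weakStar H H] (A : Set (H →L[ℂ] H)))
    (hB : IsClosed[weakStar K K] (B : Set (K →L[ℂ] K))) {p : H →L[ℂ] H} (hp : IsStarProjection p)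
    (hpA : p ∈ A) (U : K →L[ℂ] H) (U' : H →L[ℂ] K) (hU' : ContinuousLinearMap.adjoint U = U')
    (hU : U ∘L U' = p) (h1 : ∀ b ∈ B, U ∘L b ∘L U' ∈ A)
    (h2 : ∀ b ∈ B, U' ∘L (U ∘L b ∘L U') ∘L U = b) (h3 : ∀ a ∈ A, U' ∘L a ∘L U ∈ B)
    (h4 : U ∘L U' ∘L U = U) : DeltaEmbeds.{0, 0, w} B A :=
  ⟨_, inferInstance, inferInstance, inferInstance, _, inferInstance, inferInstance,
    inferInstance, conjHom (liftEquiv.{0, w} H) A, conjHom (liftEquiv.{0, w} K) B,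
    conjHom_isNormalCI _ A, conjHom_isNormalCI _ B,
    TROEmbeds.of_partialIsometry _ _ hA hB hp hpA U U' hU' hU h1 h2 h3 h4⟩

end PartialIsometry

/-! ### Left annihilators as an order invariant -/

section Annihilators

/-- `I` is the left annihilator of a left ideal (a subset closed under left multiplication). -/
def IsLeftAnnihilator {R : Type*} [NonUnitalSemiring R] (I : Set R) : Prop :=
  ∃ J : Set R, (∀ a, ∀ j ∈ J, a * j ∈ J) ∧ I = {x | ∀ j ∈ J, x * j = 0}

/-- The poset of left annihilators of left ideals of `R`. -/
abbrev LeftAnnihilators (R : Type*) [NonUnitalSemiring R] : Type _ :=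
  {I : Set R // IsLeftAnnihilator I}

theorem IsLeftAnnihilator.preimage {R S : Type*} [NonUnitalSemiring R] [NonUnitalSemiring S]
    (e : R ≃+* S) {I : Set S} (hI : IsLeftAnnihilator I) : IsLeftAnnihilator (e ⁻¹' I) := by
  obtain ⟨J, hJ, rfl⟩ := hI
  refine ⟨e ⁻¹' J, fun a j hj => ?_, ?_⟩
  · rw [Set.mem_preimage, map_mul]
    exact hJ _ _ hj
  · ext x
    simp only [Set.mem_preimage, Set.mem_ofPred_eq]
    constructor
    · intro h j hj
      apply e.injective
      rw [map_mul, map_zero, h _ hj]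
    · intro h j hj
      have := congrArg e (h (e.symm j) (by simpa using hj))
      simpa using this

/-- Isomorphic rings have isomorphic posets of left annihilators. -/
def LeftAnnihilators.congr {R S : Type*} [NonUnitalSemiring R] [NonUnitalSemiring S]
    (e : R ≃+* S) : LeftAnnihilators R ≃o LeftAnnihilators S where
  toFun I := ⟨e.symm ⁻¹' I, I.2.preimage e.symm⟩
  invFun I := ⟨e ⁻¹' I, I.2.preimage e⟩
  left_inv I := Subtype.ext (by ext x; simp)
  right_inv I := Subtype.ext (by ext x; simp)
  map_rel_iff' {I I'} := by
    change e.symm ⁻¹' (I : Set R) ⊆ e.symm ⁻¹' (I' : Set R) ↔ (I : Set R) ⊆ I'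
    exact e.symm.surjective.preimage_subset_preimage_iff

end Annihilators

/-! ### Transfer of left annihilators along a ternary ring -/

section TRO

variable {H : Type*} [NormedAddCommGroup H] [InnerProductSpace ℂ H] [CompleteSpace H]
variable {K : Type*} [NormedAddCommGroup K] [InnerProductSpace ℂ K] [CompleteSpace K]

open ContinuousLinearMap (adjoint)

/-- Subspaces `M` and `M'` (the adjoints of `M`, for a ternary ring of operators `M`) which
implement an equivalence of the operator algebras `A` and `B`. -/
structure Implements (M : Submodule ℂ (H →L[ℂ] K)) (M' : Submodule ℂ (K →L[ℂ] H))
    (A : NonUnitalSubalgebra ℂ (H →L[ℂ] H)) (B : NonUnitalSubalgebra ℂ (K →L[ℂ] K)) : Prop where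
  tro : ∀ l ∈ M, ∀ m ∈ M', ∀ n ∈ M, l ∘L m ∘L n ∈ M
  tro' : ∀ l ∈ M', ∀ m ∈ M, ∀ n ∈ M', l ∘L m ∘L n ∈ M'
  left : (A : Set (H →L[ℂ] H)) = wspan {x | ∃ m ∈ M', ∃ b ∈ B, ∃ n ∈ M, x = m ∘L b ∘L n}
  right : (B : Set (K →L[ℂ] K)) = wspan {x | ∃ m ∈ M, ∃ a ∈ A, ∃ n ∈ M', x = m ∘L a ∘L n}

/-- Treating M* as a second subspace M' makes the conditions symmetric under exchanging (M, A) with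
(M', B), so each later lemma also serves in the other direction through `Implements.symm`. -/
theorem TROEquiv.exists_implements {A : NonUnitalSubalgebra ℂ (H →L[ℂ] H)}
    {B : NonUnitalSubalgebra ℂ (K →L[ℂ] K)} (h : TROEquiv A B) : ∃ M M', Implements M M' A B := by
  obtain ⟨M, hM, hA, hB⟩ := h
  let M' : Submodule ℂ (K →L[ℂ] H) :=
    { carrier := {x | adjoint x ∈ M}
      zero_mem' := by simp
      add_mem' := fun {x y} hx hy => by
        simp only [Set.mem_ofPred_eq, map_add] at *
        exact M.add_mem hx hy
      smul_mem' := fun c x hx => by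
        simp only [Set.mem_ofPred_eq, map_smulₛₗ] at *
        exact M.smul_mem _ hx }
  have hadj : ∀ m ∈ M, adjoint m ∈ M' := fun m hm => by simpa [M'] using hm
  refine ⟨M, M', ?_, ?_, ?_, ?_⟩
  · intro l hl m hm n hn
    simpa using hM l hl _ hm n hn
  · intro l hl m hm n hn
    change adjoint _ ∈ M
    rw [ContinuousLinearMap.adjoint_comp, ContinuousLinearMap.adjoint_comp,
      ContinuousLinearMap.comp_assoc]
    exact hM _ hn _ hm _ hl
  · rw [hA]
    congr 1
    ext x
    constructor
    · rintro ⟨m, hm, b, hb, n, hn, rfl⟩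
      exact ⟨_, hadj m hm, b, hb, n, hn, rfl⟩
    · rintro ⟨m, hm, b, hb, n, hn, rfl⟩
      exact ⟨_, hm, b, hb, n, hn, by simp⟩
  · rw [hB]
    congr 1
    ext x
    constructor
    · rintro ⟨m, hm, b, hb, n, hn, rfl⟩
      exact ⟨m, hm, b, hb, _, hadj n hn, rfl⟩
    · rintro ⟨m, hm, b, hb, n, hn, rfl⟩
      exact ⟨m, hm, b, hb, _, hn, by simp⟩

namespace Implements

variable {M : Submodule ℂ (H →L[ℂ] K)} {M' : Submodule ℂ (K →L[ℂ] H)}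
  {A : NonUnitalSubalgebra ℂ (H →L[ℂ] H)} {B : NonUnitalSubalgebra ℂ (K →L[ℂ] K)}

omit [CompleteSpace H] [CompleteSpace K] in
protected theorem symm (h : Implements M M' A B) : Implements M' M B A :=
  ⟨h.tro', h.tro, h.right, h.left⟩

omit [CompleteSpace H] [CompleteSpace K] in
theorem isClosed (h : Implements M M' A B) :
    IsClosed[weakStar H H] (A : Set (H →L[ℂ] H)) := by
  rw [h.left]
  exact isClosed_wspan _

omit [CompleteSpace H] [CompleteSpace K] in
theorem comp_mem (h : Implements M M' A B) {m : K →L[ℂ] H} (hm : m ∈ M') {b : K →L[ℂ] K}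
    (hb : b ∈ B) {n : H →L[ℂ] K} (hn : n ∈ M) : m ∘L b ∘L n ∈ A := by
  have : m ∘L b ∘L n ∈ (A : Set (H →L[ℂ] H)) := by
    rw [h.left]
    exact subset_wspan _ ⟨m, hm, b, hb, n, hn, rfl⟩
  exact this

omit [CompleteSpace H] [CompleteSpace K] in
theorem mem_wspan (h : Implements M M' A B) {a : H →L[ℂ] H} (ha : a ∈ A) :
    a ∈ wspan {x : H →L[ℂ] H | ∃ m ∈ M', ∃ b ∈ B, ∃ n ∈ M, x = m ∘L b ∘L n} := by
  rw [← h.left]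
  exact ha

-- On a generator kbl of A the ternary relation absorbs the new factors: kb(lmn) with lmn ∈ M. Thus
-- A is stable under M'M, although M'M is not assumed to lie in A.
omit [CompleteSpace K] in
theorem mul_right_mem (h : Implements M M' A B) {a : H →L[ℂ] H} (ha : a ∈ A) {m : K →L[ℂ] H}
    (hm : m ∈ M') {n : H →L[ℂ] K} (hn : n ∈ M) : a ∘L m ∘L n ∈ A := by
  refine comp_mem_of_mem_wspan (h.mem_wspan ha) (ContinuousLinearMap.id ℂ H) (m ∘L n)
    A.toSubmodule h.isClosed ?_
  rintro _ ⟨k, hk, b, hb, l, hl, rfl⟩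
  exact h.comp_mem hk hb (h.tro l hl m hm n hn)

omit [CompleteSpace K] in
theorem mul_left_mem (h : Implements M M' A B) {a : H →L[ℂ] H} (ha : a ∈ A) {m : K →L[ℂ] H}
    (hm : m ∈ M') {n : H →L[ℂ] K} (hn : n ∈ M) : m ∘L n ∘L a ∈ A := by
  refine comp_mem_of_mem_wspan (h.mem_wspan ha) (m ∘L n) (ContinuousLinearMap.id ℂ H)
    A.toSubmodule h.isClosed ?_
  rintro _ ⟨k, hk, b, hb, l, hl, rfl⟩
  exact h.comp_mem (h.tro' m hm n hn k hk) hb hl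

-- Every generator of A has its rightmost factor in M, so A kills whatever M kills. With a unit at
-- hand this permits cancelling factors from M on the left.
omit [CompleteSpace K] in
theorem comp_eq_zero_left {X : Type*} [NormedAddCommGroup X] [InnerProductSpace ℂ X]
    (h : Implements M M' A B) {y : X →L[ℂ] H}
    (hy : ∀ n ∈ M, n ∘L y = 0) {a : H →L[ℂ] H} (ha : a ∈ A) : a ∘L y = 0 := by
  refine comp_eq_zero_of_mem_wspan (h.mem_wspan ha) (ContinuousLinearMap.id ℂ H) y ?_
  rintro _ ⟨k, hk, b, hb, l, hl, rfl⟩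
  change k ∘L b ∘L (l ∘L y) = 0
  rw [hy l hl, ContinuousLinearMap.comp_zero, ContinuousLinearMap.comp_zero]

theorem comp_eq_zero_right (h : Implements M M' A B) {y : H →L[ℂ] K}
    (hy : ∀ m ∈ M', y ∘L m = 0) {a : H →L[ℂ] H} (ha : a ∈ A) : y ∘L a = 0 := by
  refine comp_eq_zero_of_mem_wspan (h.mem_wspan ha) y (ContinuousLinearMap.id ℂ H) ?_
  rintro _ ⟨k, hk, b, hb, l, hl, rfl⟩
  change (y ∘L k) ∘L (b ∘L l) = 0
  rw [hy k hk, ContinuousLinearMap.zero_comp]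

/-- The elements `b` of `B` with `M' b M ⊆ I`. -/
def transfer (h : Implements M M' A B) (I : Set A) : Set B :=
  {b | ∀ m (hm : m ∈ M') n (hn : n ∈ M), (⟨m ∘L b ∘L n, h.comp_mem hm b.2 hn⟩ : A) ∈ I}

-- The left factor from M' can be cancelled: what M' kills is killed by the unit f of B, and fb = b.
omit [CompleteSpace H] in
theorem mem_transfer_iff (h : Implements M M' A B) (f : B) (hf : ∀ b : B, f * b = b) (J : Set A)
    (b : B) : b ∈ h.transfer {x | ∀ j ∈ J, x * j = 0} ↔
      ∀ n ∈ M, ∀ j ∈ J, (b : K →L[ℂ] K) ∘L n ∘L (j : H →L[ℂ] H) = 0 := by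
  constructor
  · intro hb n hn j hj
    have h1 : (f : K →L[ℂ] K) ∘L ((b : K →L[ℂ] K) ∘L n ∘L (j : H →L[ℂ] H)) = 0 :=
      h.symm.comp_eq_zero_left (y := (b : K →L[ℂ] K) ∘L n ∘L (j : H →L[ℂ] H))
        (fun m hm => congrArg Subtype.val (hb m hm n hn j hj)) f.2
    have h2 : (f : K →L[ℂ] K) ∘L (b : K →L[ℂ] K) = b := congrArg Subtype.val (hf b)
    rwa [← ContinuousLinearMap.comp_assoc, h2] at h1
  · intro hb m hm n hn j hj
    refine Subtype.ext ?_
    change m ∘L ((b : K →L[ℂ] K) ∘L n ∘L (j : H →L[ℂ] H)) = 0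
    rw [hb n hn j hj, ContinuousLinearMap.comp_zero]

theorem isLeftAnnihilator_transfer (h : Implements M M' A B) (e : A) (he : ∀ a : A, a * e = a)
    (f : B) (hf : ∀ b : B, f * b = b) (hf' : ∀ b : B, b * f = b)
    {I : Set A} (hI : IsLeftAnnihilator I) : IsLeftAnnihilator (h.transfer I) := by
  obtain ⟨J, hJ, rfl⟩ := hI
  -- The transferred set is the annihilator of the products in B M J M'. The leading factor from B
  -- makes them stable under left multiplication; it is expanded below as kal with aln ∈ A, so that
  -- alnj ∈ J.
  refine ⟨{x | ∃ d ∈ B, ∃ n ∈ M, ∃ j ∈ J, ∃ m ∈ M',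
    (x : K →L[ℂ] K) = d ∘L n ∘L (j : H →L[ℂ] H) ∘L m}, ?_, ?_⟩
  · rintro a x ⟨d, hd, n, hn, j, hj, m, hm, hx⟩
    refine ⟨a * d, B.mul_mem a.2 hd, n, hn, j, hj, m, hm, ?_⟩
    change (a : K →L[ℂ] K) ∘L (x : K →L[ℂ] K) = _
    rw [hx]
    rfl
  · ext b
    rw [h.mem_transfer_iff f hf]
    constructor
    · rintro hb x ⟨d, hd, n, hn, j, hj, m, hm, hx⟩
      refine Subtype.ext ?_
      change (b : K →L[ℂ] K) ∘L (x : K →L[ℂ] K) = 0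
      rw [hx]
      refine comp_eq_zero_of_mem_wspan (h.symm.mem_wspan hd) (b : K →L[ℂ] K)
        (n ∘L (j : H →L[ℂ] H) ∘L m) ?_
      rintro _ ⟨k, hk, a, ha, l, hl, rfl⟩
      have := hb k hk _ (hJ ⟨_, h.mul_right_mem ha hl hn⟩ j hj)
      change ((b : K →L[ℂ] K) ∘L k ∘L ((a ∘L l ∘L n) ∘L (j : H →L[ℂ] H))) ∘L m = 0
      rw [show k ∘L ((a ∘L l ∘L n) ∘L (j : H →L[ℂ] H)) = k ∘L
        ((⟨_, h.mul_right_mem ha hl hn⟩ * j : A) : H →L[ℂ] H) from rfl, this,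
        ContinuousLinearMap.zero_comp]
    · intro hb n hn j hj
      -- Here the leading factor from B is specialised to the unit f, and the trailing factor from
      -- M' is cancelled by the unit e of A.
      have h1 : ((b : K →L[ℂ] K) ∘L n ∘L (j : H →L[ℂ] H)) ∘L (e : H →L[ℂ] H) = 0 := by
        refine h.comp_eq_zero_right (fun m hm => ?_) e.2
        have hmem : (f : K →L[ℂ] K) ∘L n ∘L (j : H →L[ℂ] H) ∘L m ∈ B :=
          B.mul_mem f.2 (h.symm.comp_mem hn j.2 hm)
        have h3 := congrArg Subtype.val (hb ⟨_, hmem⟩ ⟨f, f.2, n, hn, j, hj, m, hm, rfl⟩)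
        have h2 : (b : K →L[ℂ] K) ∘L (f : K →L[ℂ] K) = b := congrArg Subtype.val (hf' b)
        change ((b : K →L[ℂ] K) ∘L (f : K →L[ℂ] K)) ∘L n ∘L (j : H →L[ℂ] H) ∘L m = 0 at h3
        rwa [h2] at h3
      have h2 : (j : H →L[ℂ] H) ∘L (e : H →L[ℂ] H) = j := congrArg Subtype.val (he j)
      rwa [ContinuousLinearMap.comp_assoc, ContinuousLinearMap.comp_assoc, h2] at h1

/-- Going back and forth gives the c with M c M'M J = 0, and M on the left cancels. If cJ = 0 then c
M'MJ = 0, because M'MJ = (M'Me)J ⊆ J. Conversely e lies in the closed span of M'BM and B in that of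
MAM', while AM'M ⊆ A and AJ ⊆ J, so c M'MJ = 0 forces cej = cj = 0. -/
theorem transfer_transfer (h : Implements M M' A B) (e : A) (he : ∀ a : A, e * a = a)
    (f : B) (hf : ∀ b : B, f * b = b)
    {I : Set A} (hI : IsLeftAnnihilator I) : h.symm.transfer (h.transfer I) = I := by
  obtain ⟨J, hJ, rfl⟩ := hI
  ext c
  have key : c ∈ h.symm.transfer (h.transfer {x | ∀ j ∈ J, x * j = 0}) ↔
      ∀ m ∈ M, ∀ n ∈ M', ∀ l ∈ M, ∀ j ∈ J,
        m ∘L (c : H →L[ℂ] H) ∘L n ∘L l ∘L (j : H →L[ℂ] H) = 0 := by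
    constructor
    · intro hc m hm n hn
      exact (h.mem_transfer_iff f hf J _).1 (hc m hm n hn)
    · intro hc m hm n hn
      exact (h.mem_transfer_iff f hf J _).2 (hc m hm n hn)
  have hej : ∀ a : A, (e : H →L[ℂ] H) ∘L (a : H →L[ℂ] H) = a :=
    fun a => congrArg Subtype.val (he a)
  rw [key]
  constructor
  · intro hc j hj
    have h1 : ∀ n ∈ M', ∀ l ∈ M, ∀ j ∈ J,
        (c : H →L[ℂ] H) ∘L n ∘L l ∘L (j : H →L[ℂ] H) = 0 := by
      intro n hn l hl j hj
      have := h.comp_eq_zero_left (fun m hm => hc m hm n hn l hl j hj) e.2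
      rwa [← ContinuousLinearMap.comp_assoc, hej] at this
    have h2 : (c : H →L[ℂ] H) ∘L (e : H →L[ℂ] H) ∘L (j : H →L[ℂ] H) = 0 := by
      refine comp_eq_zero_of_mem_wspan (h.mem_wspan e.2) _ _ ?_
      rintro _ ⟨k, hk, d, hd, l, hl, rfl⟩
      change ((c : H →L[ℂ] H) ∘L k) ∘L d ∘L (l ∘L (j : H →L[ℂ] H)) = 0
      refine comp_eq_zero_of_mem_wspan (h.symm.mem_wspan hd) _ _ ?_
      rintro _ ⟨m, hm, a, ha, n, hn, rfl⟩
      exact h1 k hk m hm _ (hJ ⟨_, h.mul_right_mem ha hn hl⟩ j hj)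
    rw [hej] at h2
    exact Subtype.ext h2
  · intro hc m hm n hn l hl j hj
    have h1 := congrArg Subtype.val (hc _ (hJ ⟨_, h.mul_left_mem e.2 hn hl⟩ j hj))
    change (c : H →L[ℂ] H) ∘L n ∘L l ∘L (e : H →L[ℂ] H) ∘L (j : H →L[ℂ] H) = 0 at h1
    rw [hej] at h1
    rw [h1, ContinuousLinearMap.comp_zero]

theorem nonempty_orderIso (h : Implements M M' A B) (e : A) (he : ∀ a : A, e * a = a ∧ a * e = a)
    (f : B) (hf : ∀ b : B, f * b = b ∧ b * f = b) :
    Nonempty (LeftAnnihilators A ≃o LeftAnnihilators B) := by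
  let E : LeftAnnihilators A ≃ LeftAnnihilators B :=
    { toFun := fun I => ⟨h.transfer I, h.isLeftAnnihilator_transfer e (fun a => (he a).2) f
        (fun b => (hf b).1) (fun b => (hf b).2) I.2⟩
      invFun := fun I => ⟨h.symm.transfer I, h.symm.isLeftAnnihilator_transfer f
        (fun b => (hf b).2) e (fun a => (he a).1) (fun a => (he a).2) I.2⟩
      left_inv := fun I => Subtype.ext (h.transfer_transfer e (fun a => (he a).1) f
        (fun b => (hf b).1) I.2)
      right_inv := fun I => Subtype.ext (h.symm.transfer_transfer f (fun b => (hf b).1) e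
        (fun a => (he a).1) I.2) }
  refine ⟨E.toOrderIso ?_ ?_⟩
  · intro I I' hI b hb m hm n hn
    exact hI (hb m hm n hn)
  · intro I I' hI b hb m hm n hn
    exact hI (hb m hm n hn)

end Implements

end TRO

/-! ### Delta-equivalence preserves the annihilator poset -/

section Delta

variable {H : Type*} [NormedAddCommGroup H] [InnerProductSpace ℂ H]
variable {K : Type*} [NormedAddCommGroup K] [InnerProductSpace ℂ K]

/-- Only 1 × 1 matrices are used: if α(a) = 0, the matrix (a) has norm zero. -/
theorem IsCompletelyIsometric.injective {A : NonUnitalSubalgebra ℂ (H →L[ℂ] H)}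
    {α : A →ₙₐ[ℂ] (K →L[ℂ] K)} (h : IsCompletelyIsometric α) : Function.Injective α := by
  refine (injective_iff_map_eq_zero α).2 fun a ha => ?_
  have h1 := h 1 (Matrix.of fun _ _ => a)
  have h2 : matrixOp ((Matrix.of fun _ _ : Fin 1 => a).map fun x => α x) = 0 := by
    ext x i
    simp [matrixOp, ha]
  rw [h2] at h1
  have h0 := h1.symm.trans ContinuousLinearMap.opNorm_zero
  refine Subtype.ext (ContinuousLinearMap.ext fun x => ?_)
  have h3 := ContinuousLinearMap.le_opNorm
    (matrixOp ((Matrix.of fun _ _ : Fin 1 => a).map fun x => (x : H →L[ℂ] H)))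
    (WithLp.toLp 2 fun _ => x)
  rw [h0, zero_mul, norm_le_zero_iff] at h3
  simpa [matrixOp] using congrArg (fun y : PiLp 2 (fun _ : Fin 1 => H) => y 0) h3

/-- An injective homomorphism is an isomorphism onto its range. -/
def rangeEquiv {A : NonUnitalSubalgebra ℂ (H →L[ℂ] H)} (α : A →ₙₐ[ℂ] (K →L[ℂ] K))
    (h : Function.Injective α) : A ≃+* NonUnitalAlgHom.range α :=
  { Equiv.ofBijective (fun a => (⟨α a, a, rfl⟩ : NonUnitalAlgHom.range α))
      ⟨fun a b hab => h (congrArg Subtype.val hab), by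
        rintro ⟨_, a, rfl⟩
        exact ⟨a, rfl⟩⟩ with
    map_mul' := fun a b => Subtype.ext (map_mul α a b)
    map_add' := fun a b => Subtype.ext (map_add α a b) }

/-- Delta-equivalent unital algebras have isomorphic posets of left annihilators. -/
theorem DeltaEquiv.nonempty_orderIso [CompleteSpace H] [CompleteSpace K]
    {A : NonUnitalSubalgebra ℂ (H →L[ℂ] H)}
    {B : NonUnitalSubalgebra ℂ (K →L[ℂ] K)} (hA : IsUnitalDual A) (hB : IsUnitalDual B)
    (h : DeltaEquiv.{_, _, w} A B) : Nonempty (LeftAnnihilators A ≃o LeftAnnihilators B) := by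
  obtain ⟨-, e, heA, -, he⟩ := hA
  obtain ⟨-, f, hfB, -, hf⟩ := hB
  obtain ⟨H', _, _, _, K', _, _, _, α, β, hα, hβ, hE⟩ := h
  obtain ⟨M, M', hM⟩ := hE.exists_implements
  let E := rangeEquiv α hα.2.injective
  let F := rangeEquiv β hβ.2.injective
  have hE : ∀ a, E ⟨e, heA⟩ * a = a ∧ a * E ⟨e, heA⟩ = a := by
    intro a
    obtain ⟨a, rfl⟩ := E.surjective a
    rw [← map_mul, ← map_mul]
    exact ⟨congrArg E (Subtype.ext (he a a.2).1), congrArg E (Subtype.ext (he a a.2).2)⟩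
  have hF : ∀ a, F ⟨f, hfB⟩ * a = a ∧ a * F ⟨f, hfB⟩ = a := by
    intro a
    obtain ⟨a, rfl⟩ := F.surjective a
    rw [← map_mul, ← map_mul]
    exact ⟨congrArg F (Subtype.ext (hf a a.2).1), congrArg F (Subtype.ext (hf a a.2).2)⟩
  obtain ⟨g⟩ := hM.nonempty_orderIso _ hE _ hF
  exact ⟨((LeftAnnihilators.congr E).trans g).trans (LeftAnnihilators.congr F).symm⟩

end Delta

/-! ### Invariant subspaces of nest algebras and annihilators in their corners -/

section NestAlgebra

variable {H : Type*} [NormedAddCommGroup H] [InnerProductSpace ℂ H] [CompleteSpace H]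

theorem proj_apply_apply {l : H →L[ℂ] H} (hl : IsStarProjection l) (v : H) : l (l v) = l v :=
  DFunLike.congr_fun hl.isIdempotentElem v

theorem mem_range_proj {l : H →L[ℂ] H} (hl : IsStarProjection l) {v : H} :
    v ∈ l.range ↔ l v = v := by
  constructor
  · rintro ⟨u, rfl⟩
    exact proj_apply_apply hl u
  · intro h
    exact ⟨v, h⟩

theorem inner_proj_left {l : H →L[ℂ] H} (hl : IsStarProjection l) (u v : H) :
    ⟪l u, v⟫_ℂ = ⟪u, l v⟫_ℂ := by
  have h : ContinuousLinearMap.adjoint l = l := hl.isSelfAdjoint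
  rw [← ContinuousLinearMap.adjoint_inner_right, h]

theorem proj_sub_proj_eq_zero {k l : H →L[ℂ] H} (hk : IsStarProjection k) (hl : IsStarProjection l)
    (h : k.range ≤ l.range) (v : H) : k (v - l v) = 0 := by
  have h1 : l (k (k (v - l v))) = k (k (v - l v)) := (mem_range_proj hl).1 (h ⟨_, rfl⟩)
  rw [proj_apply_apply hk] at h1
  have h2 : l (v - l v) = 0 := by rw [map_sub, proj_apply_apply hl, sub_self]
  rw [← inner_self_eq_zero (𝕜 := ℂ), inner_proj_left hk, proj_apply_apply hk,
    ← h1, ← inner_proj_left hl, h2, inner_zero_left]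

theorem inner_sub_proj_self {l : H →L[ℂ] H} (hl : IsStarProjection l) (v : H) :
    ⟪v - l v, v⟫_ℂ = ⟪v - l v, v - l v⟫_ℂ := by
  have h2 : l (v - l v) = 0 := by rw [map_sub, proj_apply_apply hl, sub_self]
  have h3 : ⟪v - l v, l v⟫_ℂ = 0 := by rw [← inner_proj_left hl, h2, inner_zero_left]
  conv_rhs => rw [inner_sub_right, h3, sub_zero]

omit [CompleteSpace H] in
theorem mem_alg {N : Set (H →L[ℂ] H)} {x : H →L[ℂ] H} :
    x ∈ Alg N ↔ ∀ l ∈ N, ∀ v, l (x (l v)) = x (l v) := by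
  refine forall₂_congr fun l _ => ?_
  rw [ContinuousLinearMap.ext_iff]
  refine forall_congr' fun v => ?_
  change x (l v) - l (x (l v)) = 0 ↔ _
  rw [sub_eq_zero, eq_comm]

omit [CompleteSpace H] in
theorem one_mem_alg {N : Set (H →L[ℂ] H)} (hN : ∀ l ∈ N, l * l = l) : 1 ∈ Alg N :=
  mem_alg.2 fun l hl v => DFunLike.congr_fun (hN l hl) v

theorem rankOne_mem_alg {N : Set (H →L[ℂ] H)} (hN : ∀ l ∈ N, IsStarProjection l) {v w : H}
    (h : ∀ l ∈ N, l w = w ∨ l v = 0) : InnerProductSpace.rankOne ℂ w v ∈ Alg N := by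
  refine mem_alg.2 fun l hl u => ?_
  simp only [InnerProductSpace.rankOne_apply, map_smul]
  rcases h l hl with h | h
  · rw [h]
  · rw [← inner_proj_left (hN l hl), h, inner_zero_left, zero_smul, zero_smul]

/-- A closed subspace invariant under the algebra of a nest is the range of an element of the
nest. -/
theorem IsNest.exists_range_eq {N : Set (H →L[ℂ] H)} (hN : IsNest N) (V : Submodule ℂ H)
    (hV : IsClosed (V : Set H)) (h : ∀ a ∈ Alg N, ∀ v ∈ V, a v ∈ V) : ∃ l ∈ N, l.range = V := by
  obtain ⟨hP, -, -, hT, hS⟩ := hN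
  -- The rank-one operator u ↦ ⟪v - lv, u⟫w belongs to the algebra and sends v to ‖v - lv‖² w.
  -- Invariance of V and w ∉ V force v = lv.
  have key : ∀ v ∈ V, ∀ w ∉ V, ∀ l ∈ N, (∀ g ∈ N, g w = w ∨ g.range ≤ l.range) → l v = v := by
    intro v hv w hw l hl hg
    by_contra hne
    have hmem : InnerProductSpace.rankOne ℂ w (v - l v) ∈ Alg N := by
      refine rankOne_mem_alg hP fun g hgN => (hg g hgN).imp_right fun hgl => ?_
      exact proj_sub_proj_eq_zero (hP g hgN) (hP l hl) hgl v
    have h1 := h _ hmem v hv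
    rw [InnerProductSpace.rankOne_apply, inner_sub_proj_self (hP l hl)] at h1
    have h2 : ⟪v - l v, v - l v⟫_ℂ ≠ 0 := by
      rw [Ne, inner_self_eq_zero, sub_eq_zero]
      exact fun h => hne h.symm
    exact hw ((V.smul_mem_iff h2).1 h1)
  -- V is squeezed between the largest element l₁ of the nest inside V and the smallest element l₂
  -- containing V; one of them equals V.
  obtain ⟨⟨l₁, h₁, e₁⟩, -⟩ := hS {k ∈ N | k.range ≤ V} fun k hk => hk.1
  obtain ⟨-, l₂, h₂, e₂⟩ := hS {k ∈ N | V ≤ k.range} fun k hk => hk.1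
  have hl₁ : l₁.range ≤ V := by
    rw [e₁]
    exact Submodule.topologicalClosure_minimal _ (iSup₂_le fun k hk => hk.2) hV
  have hl₂ : V ≤ l₂.range := by
    rw [e₂]
    exact le_iInf₂ fun k hk => hk.2
  have dich : ∀ g ∈ N, g.range ≤ V ∨ V ≤ g.range := by
    intro g hg
    refine or_iff_not_imp_left.2 fun hgV v hv => ?_
    obtain ⟨w, hw, hwV⟩ := Set.not_subset.1 hgV
    refine (mem_range_proj (hP g hg)).2 (key v hv w hwV g hg fun k hk => ?_)
    rcases hT k hk g hg with h | h
    · exact Or.inr h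
    · exact Or.inl ((mem_range_proj (hP k hk)).1 (h hw))
  by_cases hV₂ : l₂.range ≤ V
  · exact ⟨l₂, h₂, le_antisymm hV₂ hl₂⟩
  -- With w in l₂ but not in V, each element of the nest either lies in V, hence below l₁, or
  -- contains l₂ and so fixes w. Thus `key` applies to l₁.
  · obtain ⟨w, hw, hwV⟩ := Set.not_subset.1 hV₂
    refine ⟨l₁, h₁, le_antisymm hl₁ fun v hv => ?_⟩
    refine (mem_range_proj (hP l₁ h₁)).2 (key v hv w hwV l₁ h₁ fun k hk => ?_)
    rcases dich k hk with h | h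
    · refine Or.inr ?_
      rw [e₁]
      exact (le_iSup₂ (f := fun (k : H →L[ℂ] H) (_ : k ∈ {k ∈ N | k.range ≤ V}) => k.range)
        k ⟨hk, h⟩).trans (Submodule.le_topologicalClosure _)
    · refine Or.inl ((mem_range_proj (hP k hk)).1 ?_)
      have : l₂.range ≤ k.range := by
        rw [e₂]
        exact iInf₂_le k ⟨hk, h⟩
      exact this hw

/-- `B` is the corner of `A` at the projection `q ∈ A`. -/
structure IsCorner (A : NonUnitalSubalgebra ℂ (H →L[ℂ] H)) (q : H →L[ℂ] H)
    (B : NonUnitalSubalgebra ℂ (H →L[ℂ] H)) : Prop where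
  proj : IsStarProjection q
  mem : q ∈ A
  mem_iff : ∀ x, x ∈ B ↔ ∃ a ∈ A, x = q * a * q

theorem isCorner_corner (A : NonUnitalSubalgebra ℂ (H →L[ℂ] H)) (q : H →L[ℂ] H)
    (hq : IsStarProjection q) (hqA : q ∈ A) : IsCorner A q (corner A q hq hqA) :=
  ⟨hq, hqA, fun _ => Iff.rfl⟩

/-- Allows one computation of the annihilators to cover both A, with q = 1, and qAq. -/
theorem isCorner_one (A : NonUnitalSubalgebra ℂ (H →L[ℂ] H)) (h : 1 ∈ A) : IsCorner A 1 A :=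
  ⟨IsStarProjection.one _, h, fun x => ⟨fun hx => ⟨x, hx, by simp⟩, by
    rintro ⟨a, ha, rfl⟩
    simpa using ha⟩⟩

theorem IsNest.mem_alg {N : Set (H →L[ℂ] H)} (hN : IsNest N) {l : H →L[ℂ] H} (hl : l ∈ N) :
    l ∈ Alg N := by
  refine DeltaEmb.mem_alg.2 fun g hg v => ?_
  rcases hN.2.2.2.1 g hg l hl with h | h
  · have : l (g v) = g v := (mem_range_proj (hN.1 l hl)).1 (h ⟨v, rfl⟩)
    rw [this, proj_apply_apply (hN.1 g hg)]
  · exact (mem_range_proj (hN.1 g hg)).1 (h ⟨g v, rfl⟩)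

namespace IsCorner

variable {N : Set (H →L[ℂ] H)} {q : H →L[ℂ] H} {B : NonUnitalSubalgebra ℂ (H →L[ℂ] H)}

/-- Membership in the nest algebra gives lql = ql; the left side is self-adjoint, hence ql = lq. -/
theorem commute (hB : IsCorner (Alg N) q B) (hN : IsNest N) {l : H →L[ℂ] H} (hl : l ∈ N) (v : H) :
    q (l v) = l (q v) := by
  have h1 : ∀ v, l (q (l v)) = q (l v) := DeltaEmb.mem_alg.1 hB.mem l hl
  refine ext_inner_left ℂ fun u => ?_
  rw [← h1 v, ← inner_proj_left (hN.1 l hl), ← inner_proj_left hB.proj, ← inner_proj_left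
    (hN.1 l hl), h1, inner_proj_left hB.proj, inner_proj_left (hN.1 l hl)]

theorem left_apply (hB : IsCorner (Alg N) q B) {x : H →L[ℂ] H} (hx : x ∈ B) (v : H) :
    q (x v) = x v := by
  obtain ⟨a, -, rfl⟩ := (hB.mem_iff x).1 hx
  exact proj_apply_apply hB.proj _

theorem right_apply (hB : IsCorner (Alg N) q B) {x : H →L[ℂ] H} (hx : x ∈ B) (v : H) :
    x (q v) = x v := by
  obtain ⟨a, -, rfl⟩ := (hB.mem_iff x).1 hx
  change q (a (q (q v))) = q (a (q v))
  rw [proj_apply_apply hB.proj]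

theorem mul_mem (hB : IsCorner (Alg N) q B) {a : H →L[ℂ] H} (ha : a ∈ Alg N) : q * a * q ∈ B :=
  (hB.mem_iff _).2 ⟨a, ha, rfl⟩

/-- The left annihilator of an element of the nest. -/
def annih (hB : IsCorner (Alg N) q B) (hN : IsNest N) (l : N) : LeftAnnihilators B :=
  ⟨{x | (x : H →L[ℂ] H) * l = 0}, {b | (l : H →L[ℂ] H) * (b : H →L[ℂ] H) = b}, by
    intro a b hb
    have ha : (a : H →L[ℂ] H) ∈ Alg N := by
      obtain ⟨c, hc, h⟩ := (hB.mem_iff a).1 a.2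
      rw [h]
      exact (Alg N).mul_mem ((Alg N).mul_mem hB.mem hc) hB.mem
    refine ContinuousLinearMap.ext fun v => ?_
    have h1 : (l : H →L[ℂ] H) ((b : H →L[ℂ] H) v) = (b : H →L[ℂ] H) v := DFunLike.congr_fun hb v
    have h2 := DeltaEmb.mem_alg.1 ha l l.2 ((b : H →L[ℂ] H) v)
    rw [h1] at h2
    exact h2, by
    ext x
    constructor
    · intro hx b hb
      refine Subtype.ext ?_
      change (x : H →L[ℂ] H) * (b : H →L[ℂ] H) = 0
      rw [← show (l : H →L[ℂ] H) * (b : H →L[ℂ] H) = b from hb, ← mul_assoc,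
        show (x : H →L[ℂ] H) * l = 0 from hx, zero_mul]
    · intro hx
      refine ContinuousLinearMap.ext fun v => ?_
      -- The test element is qlq; since q commutes with l and xq = x, x(qlq) = xl.
      have h := congrArg Subtype.val (hx ⟨_, hB.mul_mem (hN.mem_alg l.2)⟩
        (ContinuousLinearMap.ext fun v => by
          change (l : H →L[ℂ] H) (q ((l : H →L[ℂ] H) (q v))) = q ((l : H →L[ℂ] H) (q v))
          rw [hB.commute hN l.2, proj_apply_apply (hN.1 l l.2)]))
      have h1 : (x : H →L[ℂ] H) (q ((l : H →L[ℂ] H) (q v))) = 0 := DFunLike.congr_fun h v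
      rw [hB.right_apply x.2, ← hB.commute hN l.2, hB.right_apply x.2] at h1
      exact h1⟩

/-- The order sees only the parts below q, reversed: the condition is l'q ≤ lq. Necessity comes from
q(1 - l)q, which annihilates l and so must annihilate l'. -/
theorem annih_le_annih_iff (hB : IsCorner (Alg N) q B) (hN : IsNest N) (l l' : N) :
    hB.annih hN l ≤ hB.annih hN l' ↔
      ∀ v, (l' : H →L[ℂ] H) v = v → q v = v → (l : H →L[ℂ] H) v = v := by
  constructor
  · intro h v hv hqv
    have h1 : q * (1 - l) * q ∈ B := hB.mul_mem (by
      rw [sub_eq_add_neg]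
      exact (Alg N).add_mem (one_mem_alg fun l hl => (hN.1 l hl).isIdempotentElem)
        ((Alg N).neg_mem (hN.mem_alg l.2)))
    have h2 : (⟨_, h1⟩ : B) ∈ (hB.annih hN l).1 := ContinuousLinearMap.ext fun v => by
      change q ((q ((l : H →L[ℂ] H) v)) - (l : H →L[ℂ] H) (q ((l : H →L[ℂ] H) v))) = 0
      rw [← hB.commute hN l.2, proj_apply_apply (hN.1 l l.2), sub_self, map_zero]
    have h3 : q (q ((l' : H →L[ℂ] H) v) - (l : H →L[ℂ] H) (q ((l' : H →L[ℂ] H) v))) = 0 :=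
      DFunLike.congr_fun (h h2) v
    rw [hv, hqv, map_sub, hB.commute hN l.2, hqv, sub_eq_zero] at h3
    exact h3.symm
  · intro h x hx
    refine ContinuousLinearMap.ext fun v => ?_
    change (x : H →L[ℂ] H) ((l' : H →L[ℂ] H) v) = 0
    have hx' : ∀ v, (x : H →L[ℂ] H) ((l : H →L[ℂ] H) v) = 0 := fun v => DFunLike.congr_fun hx v
    rw [← hB.right_apply x.2, ← h (q ((l' : H →L[ℂ] H) v))
      (by rw [hB.commute hN l'.2, proj_apply_apply (hN.1 l' l'.2)]) (proj_apply_apply hB.proj _), hx']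

/-- The closed span V of AJH is invariant under A, so it is the range of some l in the nest. If x ∈
B kills J, then xbj = x(qbq)j = 0 for b ∈ A, so x kills all of V. -/
theorem exists_eq_annih (hB : IsCorner (Alg N) q B) (hN : IsNest N) (I : LeftAnnihilators B) :
    ∃ l, I = hB.annih hN l := by
  obtain ⟨I, J, hJ, rfl⟩ := I
  let V := (Submodule.span ℂ
    {u : H | ∃ a ∈ Alg N, ∃ j ∈ J, ∃ v, u = a ((j : H →L[ℂ] H) v)}).topologicalClosure
  obtain ⟨l, hl, hlV⟩ := hN.exists_range_eq V (Submodule.isClosed_topologicalClosure _) (by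
    intro a ha
    change V ≤ V.comap (a : H →ₗ[ℂ] H)
    refine Submodule.topologicalClosure_minimal _ (Submodule.span_le.2 ?_)
      ((Submodule.isClosed_topologicalClosure _).preimage a.continuous)
    rintro _ ⟨b, hb, j, hj, v, rfl⟩
    exact Submodule.le_topologicalClosure _ (Submodule.subset_span
      ⟨a * b, (Alg N).mul_mem ha hb, j, hj, v, rfl⟩))
  refine ⟨⟨l, hl⟩, Subtype.ext (Set.ext fun x => ⟨fun hx => ?_, fun hx j hj => ?_⟩)⟩
  · have h : V ≤ (x : H →L[ℂ] H).ker := by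
      refine Submodule.topologicalClosure_minimal _ (Submodule.span_le.2 ?_)
        (ContinuousLinearMap.isClosed_ker _)
      rintro _ ⟨b, hb, j, hj, v, rfl⟩
      have h1 : (x : H →L[ℂ] H) (q (b (q ((j : H →L[ℂ] H) v)))) = 0 :=
        DFunLike.congr_fun (congrArg Subtype.val (hx _ (hJ ⟨_, hB.mul_mem hb⟩ j hj))) v
      rw [hB.left_apply j.2, hB.right_apply x.2] at h1
      exact h1
    refine ContinuousLinearMap.ext fun v => ?_
    exact h (hlV ▸ ⟨v, rfl⟩)
  · refine Subtype.ext (ContinuousLinearMap.ext fun v => ?_)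
    have h : (j : H →L[ℂ] H) v ∈ l.range := by
      rw [hlV]
      exact Submodule.le_topologicalClosure _ (Submodule.subset_span
        ⟨1, one_mem_alg fun l hl => (hN.1 l hl).isIdempotentElem, j, hj, v, rfl⟩)
    change (x : H →L[ℂ] H) ((j : H →L[ℂ] H) v) = 0
    rw [← (mem_range_proj (hN.1 l hl)).1 h]
    exact DFunLike.congr_fun hx _

end IsCorner

end NestAlgebra

/-! ### Coordinate subspaces and their orthogonal complements -/

section CutSpace

theorem cutSpace_mono {D D' : Set ℚ} {E E' : Set ℝ} (hD : D ⊆ D') (hE : E ⊆ E') :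
    cutSpace D E ≤ cutSpace D' E' := by
  rintro x ⟨h1, h2⟩
  refine ⟨fun r hr => h1 r fun h => hr (hD h), ?_⟩
  filter_upwards [h2] with s hs hsE using hs fun h => hsE (hE h)

theorem inner_eq_zero_of_mem_cutSpace {D : Set ℚ} {E : Set ℝ} {x y : Hsp} (hx : x ∈ cutSpace D E)
    (hy : y ∈ cutSpace Dᶜ Eᶜ) : ⟪x, y⟫_ℂ = 0 := by
  rw [WithLp.prod_inner_apply, lp.inner_eq_tsum, L2.inner_def]
  have h1 : ∀ r : RatUnit, ⟪x.fst r, y.fst r⟫_ℂ = 0 := fun r => by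
    by_cases hr : (r : ℚ) ∈ D
    · rw [hy.1 r (fun h => h hr), inner_zero_right]
    · rw [hx.1 r hr, inner_zero_left]
  have h2 : ∀ᵐ s ∂leb, ⟪x.snd s, y.snd s⟫_ℂ = 0 := by
    filter_upwards [hx.2, hy.2] with s h1 h2
    by_cases hs : s ∈ E
    · rw [h2 (fun h => h hs), inner_zero_right]
    · rw [h1 hs, inner_zero_left]
  change ∑' r, ⟪x.fst r, y.fst r⟫_ℂ + ∫ s, ⟪x.snd s, y.snd s⟫_ℂ ∂leb = 0
  rw [integral_eq_zero_of_ae h2, tsum_congr h1, tsum_zero, zero_add]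

/-- The unit vector of `ℓ²(ℚ ∩ [0,1])` at `r`. -/
def basisVec (r : RatUnit) : Hsp := WithLp.toLp 2 (lp.single 2 r 1, 0)

theorem inner_basisVec (r : RatUnit) (x : Hsp) : ⟪basisVec r, x⟫_ℂ = x.fst r := by
  rw [WithLp.prod_inner_apply, basisVec]
  change ⟪lp.single 2 r (1 : ℂ), x.fst⟫_ℂ + ⟪(0 : Lp ℂ 2 leb), x.snd⟫_ℂ = _
  rw [lp.inner_single_left, inner_zero_left, add_zero]
  simp

theorem basisVec_mem (r : RatUnit) {D : Set ℚ} (E : Set ℝ) (hr : (r : ℚ) ∈ D) :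
    basisVec r ∈ cutSpace D E := by
  refine ⟨fun r' hr' => ?_, ?_⟩
  · change (lp.single 2 r (1 : ℂ) : RatUnit → ℂ) r' = 0
    rw [lp.single_apply, Pi.single_eq_of_ne]
    rintro rfl
    exact hr' hr
  · filter_upwards [Lp.coeFn_zero ℂ 2 leb] with s hs _
    exact hs

/-- The function `1_E f`, as an element of `L²[0,1]`. -/
def cutFun {E : Set ℝ} (hE : MeasurableSet E) (f : Lp ℂ 2 leb) : Lp ℂ 2 leb :=
  ((Lp.memLp f).indicator hE).toLp (E.indicator f)

theorem cutFun_ae {E : Set ℝ} (hE : MeasurableSet E) (f : Lp ℂ 2 leb) :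
    cutFun hE f =ᵐ[leb] E.indicator f :=
  ((Lp.memLp f).indicator hE).coeFn_toLp

/-- The function `1_E f`, as an element of `ℓ²(ℚ ∩ [0,1]) ⊕ L²[0,1]`. -/
def cutVec {E : Set ℝ} (hE : MeasurableSet E) (f : Lp ℂ 2 leb) : Hsp :=
  WithLp.toLp 2 (0, cutFun hE f)

theorem cutVec_snd {E : Set ℝ} (hE : MeasurableSet E) (f : Lp ℂ 2 leb) :
    ∀ᵐ s ∂leb, (cutVec hE f).snd s = E.indicator f s :=
  cutFun_ae hE f

theorem cutVec_mem {E : Set ℝ} (hE : MeasurableSet E) (f : Lp ℂ 2 leb) (D : Set ℚ) :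
    cutVec hE f ∈ cutSpace D E := by
  refine ⟨fun r _ => rfl, ?_⟩
  filter_upwards [cutVec_snd hE f] with s hs hsE
  rw [hs, Set.indicator_of_notMem hsE]

/-- The ℓ² coordinates are read off by basis vectors. For the L² part, the truncation g of x to E
lies in the subspace, so 0 = ⟪g, x⟫ = ‖g‖². -/
theorem orthogonal_cutSpace (D : Set ℚ) {E : Set ℝ} (hE : MeasurableSet E) :
    (cutSpace D E)ᗮ = cutSpace Dᶜ Eᶜ := by
  refine le_antisymm (fun x hx => ?_) fun y hy x hx => inner_eq_zero_of_mem_cutSpace hx hy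
  refine ⟨fun r hr => ?_, ?_⟩
  · rw [← inner_basisVec]
    exact hx _ (basisVec_mem r E (not_not.1 hr))
  · let g := cutVec hE x.snd
    let z : Hsp := WithLp.toLp 2 (x.fst, x.snd - g.snd)
    -- The double complement matches g ∈ `cutSpace Set.univᶜ E`: g has no ℓ² part, and z carries the
    -- whole ℓ² part of x.
    have hz : z ∈ cutSpace Set.univᶜᶜ Eᶜ := by
      refine ⟨fun r hr => by simp at hr, ?_⟩
      filter_upwards [cutVec_snd hE x.snd, Lp.coeFn_sub x.snd g.snd] with s h1 h2 hs
      change (x.snd - g.snd : Lp ℂ 2 leb) s = 0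
      rw [h2, Pi.sub_apply, h1, Set.indicator_of_mem (not_not.1 hs), sub_self]
    have h1 : ⟪g, x⟫_ℂ = 0 := hx g (cutVec_mem hE _ D)
    have h2 : ⟪g, z⟫_ℂ = 0 := inner_eq_zero_of_mem_cutSpace (cutVec_mem hE _ _) hz
    have h3 : x = g + z := by
      apply (WithLp.equiv 2 _).injective
      refine Prod.ext ?_ ?_
      · change x.fst = 0 + x.fst
        rw [zero_add]
      · change x.snd = g.snd + (x.snd - g.snd)
        rw [add_sub_cancel]
    rw [h3, inner_add_right, h2, add_zero, inner_self_eq_zero] at h1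
    have h4 : g.snd = 0 := by rw [h1]; rfl
    filter_upwards [cutVec_snd hE x.snd, Lp.coeFn_zero ℂ 2 leb] with s h5 h6 hs
    rw [← Set.indicator_of_mem (not_not.1 hs) x.snd, ← h5]
    change g.snd s = 0
    rw [h4, h6]
    rfl

theorem range_cutProj (D : Set ℚ) (E : Set ℝ) : (cutProj D E).range = cutSpace D E :=
  Submodule.range_starProjection _

theorem cutProj_eq_self_iff {D : Set ℚ} {E : Set ℝ} {x : Hsp} :
    cutProj D E x = x ↔ x ∈ cutSpace D E :=
  Submodule.starProjection_eq_self_iff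

theorem isStarProjection_cutProj (D : Set ℚ) (E : Set ℝ) : IsStarProjection (cutProj D E) :=
  isStarProjection_starProjection

end CutSpace

/-! ### The projections form a complete nest -/

section Nest

theorem ae_leb_mem : ∀ᵐ s ∂leb, 0 ≤ s ∧ s ≤ 1 := ae_restrict_mem measurableSet_Icc

theorem mem_range_nestPlus {t : ℝ} {x : Hsp} : x ∈ (nestPlus t).range ↔
    (∀ r : RatUnit, t < (r : ℚ) → x.fst r = 0) ∧ ∀ᵐ s ∂leb, t < s → x.snd s = 0 := by
  rw [nestPlus, range_cutProj]
  refine and_congr (forall_congr' fun r => imp_congr_left ?_) (Filter.eventually_congr ?_)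
  · simp [r.2.1]
  · filter_upwards [ae_leb_mem] with s hs
    simp [hs.1]

theorem mem_range_nestMinus {t : ℝ} {x : Hsp} : x ∈ (nestMinus t).range ↔
    (∀ r : RatUnit, t ≤ (r : ℚ) → x.fst r = 0) ∧ ∀ᵐ s ∂leb, t < s → x.snd s = 0 := by
  rw [nestMinus, range_cutProj]
  refine and_congr (forall_congr' fun r => imp_congr_left ?_) (Filter.eventually_congr ?_)
  · simp [r.2.1]
  · filter_upwards [ae_leb_mem] with s hs
    simp [hs.1]

theorem mem_orthogonal_nestPlus {t : ℝ} {x : Hsp} : x ∈ (nestPlus t).rangeᗮ ↔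
    (∀ r : RatUnit, ((r : ℚ) : ℝ) ≤ t → x.fst r = 0) ∧ ∀ᵐ s ∂leb, s ≤ t → x.snd s = 0 := by
  rw [nestPlus, range_cutProj, orthogonal_cutSpace _ measurableSet_Icc]
  refine and_congr (forall_congr' fun r => imp_congr_left ?_) (Filter.eventually_congr ?_)
  · simp [r.2.1]
  · filter_upwards [ae_leb_mem] with s hs
    simp [hs.1]

theorem mem_orthogonal_nestMinus {t : ℝ} {x : Hsp} : x ∈ (nestMinus t).rangeᗮ ↔
    (∀ r : RatUnit, ((r : ℚ) : ℝ) < t → x.fst r = 0) ∧ ∀ᵐ s ∂leb, s ≤ t → x.snd s = 0 := by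
  rw [nestMinus, range_cutProj, orthogonal_cutSpace _ measurableSet_Icc]
  refine and_congr (forall_congr' fun r => imp_congr_left ?_) (Filter.eventually_congr ?_)
  · simp [r.2.1]
  · filter_upwards [ae_leb_mem] with s hs
    simp [hs.1]

theorem nestPlus_le_nestPlus {s t : ℝ} (h : s ≤ t) : (nestPlus s).range ≤ (nestPlus t).range := by
  rw [nestPlus, range_cutProj, nestPlus, range_cutProj]
  exact cutSpace_mono (fun r hr => ⟨hr.1, hr.2.trans h⟩) (Set.Icc_subset_Icc_right h)

theorem nestMinus_le_nestMinus {s t : ℝ} (h : s ≤ t) :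
    (nestMinus s).range ≤ (nestMinus t).range := by
  rw [nestMinus, range_cutProj, nestMinus, range_cutProj]
  exact cutSpace_mono (fun r hr => ⟨hr.1, hr.2.trans_le h⟩) (Set.Icc_subset_Icc_right h)

theorem nestMinus_le_nestPlus {s t : ℝ} (h : s ≤ t) :
    (nestMinus s).range ≤ (nestPlus t).range := by
  rw [nestMinus, range_cutProj, nestPlus, range_cutProj]
  exact cutSpace_mono (fun r hr => ⟨hr.1, hr.2.le.trans h⟩) (Set.Icc_subset_Icc_right h)

theorem nestPlus_le_nestMinus {s t : ℝ} (h : s < t) :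
    (nestPlus s).range ≤ (nestMinus t).range := by
  rw [nestPlus, range_cutProj, nestMinus, range_cutProj]
  exact cutSpace_mono (fun r hr => ⟨hr.1, hr.2.trans_lt h⟩) (Set.Icc_subset_Icc_right h.le)

theorem nestPlus_one : nestPlus 1 = 1 := by
  refine ContinuousLinearMap.ext fun x => cutProj_eq_self_iff.2 ⟨fun r hr => ?_, ?_⟩
  · exact absurd ⟨r.2.1, by exact_mod_cast r.2.2⟩ hr
  · filter_upwards [ae_leb_mem] with s hs h
    exact absurd hs h

theorem ae_leb_ne (t : ℝ) : ∀ᵐ s ∂leb, s ≠ t := by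
  refine ae_restrict_of_ae ?_
  rw [ae_iff]
  simp

theorem nestMinus_zero : nestMinus 0 = 0 := by
  refine ContinuousLinearMap.ext fun x => ?_
  have h : nestMinus 0 x ∈ (nestMinus 0).range := ⟨x, rfl⟩
  obtain ⟨h1, h2⟩ := mem_range_nestMinus.1 h
  have h3 : (nestMinus 0 x).fst = 0 := lp.ext (funext fun r => h1 r (by exact_mod_cast r.2.1))
  have h4 : (nestMinus 0 x).snd = 0 := by
    refine Lp.ext ?_
    filter_upwards [h2, ae_leb_mem, ae_leb_ne 0, Lp.coeFn_zero ℂ 2 leb] with s h2 h5 h6 h7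
    rw [h7, h2 (lt_of_le_of_ne h5.1 (Ne.symm h6))]
    rfl
  exact (WithLp.equiv 2 _).injective (Prod.ext h3 h4)

theorem isStarProjection_of_mem_theNest {l : Hsp →L[ℂ] Hsp} (hl : l ∈ theNest) :
    IsStarProjection l := by
  obtain ⟨t, -, rfl | rfl⟩ := hl <;> exact isStarProjection_cutProj _ _

theorem theNest_total {k l : Hsp →L[ℂ] Hsp} (hk : k ∈ theNest) (hl : l ∈ theNest) :
    k.range ≤ l.range ∨ l.range ≤ k.range := by
  obtain ⟨s, -, hk⟩ := hk
  obtain ⟨t, -, hl⟩ := hl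
  rcases lt_trichotomy s t with h | rfl | h
  · left
    rcases hk with rfl | rfl <;> rcases hl with rfl | rfl
    exacts [nestPlus_le_nestPlus h.le, nestPlus_le_nestMinus h, nestMinus_le_nestPlus h.le,
      nestMinus_le_nestMinus h.le]
  · rcases hk with rfl | rfl <;> rcases hl with rfl | rfl
    exacts [Or.inl le_rfl, Or.inr (nestMinus_le_nestPlus le_rfl),
      Or.inl (nestMinus_le_nestPlus le_rfl), Or.inl le_rfl]
  · right
    rcases hk with rfl | rfl <;> rcases hl with rfl | rfl
    exacts [nestPlus_le_nestPlus h.le, nestMinus_le_nestPlus h.le, nestPlus_le_nestMinus h,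
      nestMinus_le_nestMinus h.le]

/-- The parameters of the elements of a subset of the nest. -/
def params (S : Set (Hsp →L[ℂ] Hsp)) : Set ℝ :=
  {t | t ∈ Set.Icc (0 : ℝ) 1 ∧ (nestPlus t ∈ S ∨ nestMinus t ∈ S)}

theorem params_nonempty {S : Set (Hsp →L[ℂ] Hsp)} (hS : S ⊆ theNest) (h : S.Nonempty) :
    (params S).Nonempty := by
  obtain ⟨l, hl⟩ := h
  obtain ⟨t, ht, rfl | rfl⟩ := hS hl
  exacts [⟨t, ht, Or.inl hl⟩, ⟨t, ht, Or.inr hl⟩]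

/-- Let s be the infimum of the parameters. If `nestMinus s` is in S it is the minimum. Otherwise
every minus element of S has parameter > s, and parameters tending to s show that the intersection
is `nestPlus s`. -/
theorem theNest_exists_iInf {S : Set (Hsp →L[ℂ] Hsp)} (hS : S ⊆ theNest) :
    ∃ l ∈ theNest, l.range = ⨅ k ∈ S, k.range := by
  rcases S.eq_empty_or_nonempty with rfl | hne
  · refine ⟨nestPlus 1, ⟨1, by simp, Or.inl rfl⟩, ?_⟩
    rw [nestPlus_one]
    simp only [Set.mem_empty_iff_false, iInf_false, iInf_top]
    exact LinearMap.range_id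
  have hT := params_nonempty hS hne
  have hbdd : BddBelow (params S) := ⟨0, fun t ht => ht.1.1⟩
  obtain ⟨u, -, hu, huT⟩ := exists_seq_tendsto_sInf hT hbdd
  set s := sInf (params S) with hs
  have hle : ∀ t ∈ params S, s ≤ t := fun t ht => csInf_le hbdd ht
  have hs01 : s ∈ Set.Icc (0 : ℝ) 1 :=
    ⟨le_csInf hT fun t ht => ht.1.1, (hle _ (huT 0)).trans (huT 0).1.2⟩
  by_cases hm : nestMinus s ∈ S
  · refine ⟨nestMinus s, hS hm, le_antisymm (le_iInf₂ fun k hk => ?_) (iInf₂_le _ hm)⟩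
    obtain ⟨t, ht, rfl | rfl⟩ := hS hk
    exacts [nestMinus_le_nestPlus (hle t ⟨ht, Or.inl hk⟩),
      nestMinus_le_nestMinus (hle t ⟨ht, Or.inr hk⟩)]
  · refine ⟨nestPlus s, ⟨s, hs01, Or.inl rfl⟩, le_antisymm (le_iInf₂ fun k hk => ?_) fun x hx => ?_⟩
    · obtain ⟨t, ht, rfl | rfl⟩ := hS hk
      · exact nestPlus_le_nestPlus (hle t ⟨ht, Or.inl hk⟩)
      · refine nestPlus_le_nestMinus (lt_of_le_of_ne (hle t ⟨ht, Or.inr hk⟩) ?_)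
        intro h
        exact hm (h ▸ hk)
    · have hx' : ∀ n, x ∈ (nestPlus (u n)).range := fun n => by
        obtain ⟨-, h | h⟩ := huT n
        · exact (iInf₂_le (nestPlus (u n)) h : _ ≤ (nestPlus (u n)).range) hx
        · exact nestMinus_le_nestPlus le_rfl
            ((iInf₂_le (nestMinus (u n)) h : _ ≤ (nestMinus (u n)).range) hx)
      refine mem_range_nestPlus.2 ⟨fun r hr => ?_, ?_⟩
      · obtain ⟨n, hn⟩ := (hu.eventually_lt_const hr).exists
        exact (mem_range_nestPlus.1 (hx' n)).1 r hn
      · filter_upwards [ae_all_iff.2 fun n => (mem_range_nestPlus.1 (hx' n)).2] with a ha hsa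
        obtain ⟨n, hn⟩ := (hu.eventually_lt_const hsa).exists
        exact ha n hn

theorem theNest_exists_iSup {S : Set (Hsp →L[ℂ] Hsp)} (hS : S ⊆ theNest) :
    ∃ l ∈ theNest, l.range = (⨆ k ∈ S, k.range).topologicalClosure := by
  have hcl : ∀ l ∈ theNest, (∀ k ∈ S, k.range ≤ l.range) →
      (⨆ k ∈ S, k.range).topologicalClosure ≤ l.range := by
    intro l hl h
    refine Submodule.topologicalClosure_minimal _ (iSup₂_le h) ?_
    obtain ⟨t, -, rfl | rfl⟩ := hl
    · rw [nestPlus, range_cutProj]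
      exact isClosed_cutSpace _ _
    · rw [nestMinus, range_cutProj]
      exact isClosed_cutSpace _ _
  rcases S.eq_empty_or_nonempty with rfl | hne
  · have h0 : nestMinus 0 ∈ theNest := ⟨0, by simp, Or.inr rfl⟩
    refine ⟨nestMinus 0, h0, le_antisymm ?_ (hcl _ h0 (by simp))⟩
    rw [nestMinus_zero]
    rintro _ ⟨x, rfl⟩
    exact Submodule.zero_mem _
  have hT := params_nonempty hS hne
  have hbdd : BddAbove (params S) := ⟨1, fun t ht => ht.1.2⟩
  obtain ⟨u, -, hu, huT⟩ := exists_seq_tendsto_sSup hT hbdd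
  set s := sSup (params S) with hs
  have hle : ∀ t ∈ params S, t ≤ s := fun t ht => le_csSup hbdd ht
  have hs01 : s ∈ Set.Icc (0 : ℝ) 1 :=
    ⟨(huT 0).1.1.trans (hle _ (huT 0)), csSup_le hT fun t ht => ht.1.2⟩
  have hsub : ∀ k ∈ S, k.range ≤ ⨆ k ∈ S, k.range := fun k hk =>
    le_iSup₂ (f := fun (k : Hsp →L[ℂ] Hsp) (_ : k ∈ S) => k.range) k hk
  by_cases hm : nestPlus s ∈ S
  · refine ⟨nestPlus s, hS hm, le_antisymm ((hsub _ hm).trans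
      (Submodule.le_topologicalClosure _)) (hcl _ (hS hm) fun k hk => ?_)⟩
    obtain ⟨t, ht, rfl | rfl⟩ := hS hk
    exacts [nestPlus_le_nestPlus (hle t ⟨ht, Or.inl hk⟩),
      nestMinus_le_nestPlus (hle t ⟨ht, Or.inr hk⟩)]
  · have hl : nestMinus s ∈ theNest := ⟨s, hs01, Or.inr rfl⟩
    refine ⟨nestMinus s, hl, le_antisymm (fun x hx => ?_) (hcl _ hl fun k hk => ?_)⟩
    -- Passing to orthogonal complements turns the closed span into an intersection, again described
    -- by vanishing of coordinates.
    · rw [← Submodule.orthogonal_orthogonal_eq_closure]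
      intro y hy
      have hy' : ∀ n, y ∈ (nestMinus (u n)).rangeᗮ := fun n => by
        obtain ⟨-, h | h⟩ := huT n
        · exact Submodule.orthogonal_le ((nestMinus_le_nestPlus le_rfl).trans (hsub _ h)) hy
        · exact Submodule.orthogonal_le (hsub _ h) hy
      have hys : y ∈ (nestMinus s).rangeᗮ := by
        refine mem_orthogonal_nestMinus.2 ⟨fun r hr => ?_, ?_⟩
        · obtain ⟨n, hn⟩ := (hu.eventually_const_lt hr).exists
          exact (mem_orthogonal_nestMinus.1 (hy' n)).1 r hn
        -- The intervals [0, u n] are only sure to exhaust [0, s), so the null set {s} is discarded.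
        · filter_upwards [ae_all_iff.2 fun n => (mem_orthogonal_nestMinus.1 (hy' n)).2,
            ae_leb_ne s] with a ha hsa has
          obtain ⟨n, hn⟩ := (hu.eventually_const_lt (lt_of_le_of_ne has hsa)).exists
          exact ha n hn.le
      rw [← inner_conj_symm, hys x hx, map_zero]
    · obtain ⟨t, ht, rfl | rfl⟩ := hS hk
      · refine nestPlus_le_nestMinus (lt_of_le_of_ne (hle t ⟨ht, Or.inl hk⟩) ?_)
        intro h
        exact hm (h ▸ hk)
      · exact nestMinus_le_nestMinus (hle t ⟨ht, Or.inr hk⟩)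

theorem isNest_theNest : IsNest theNest :=
  ⟨fun _ hl => isStarProjection_of_mem_theNest hl,
    ⟨0, by simp, Or.inr nestMinus_zero.symm⟩, ⟨1, by simp, Or.inl nestPlus_one.symm⟩,
    fun _ hk _ hl => theNest_total hk hl,
    fun _ hS => ⟨theNest_exists_iSup hS, theNest_exists_iInf hS⟩⟩

end Nest

/-! ### The isometry induced by s ↦ s/2 -/

section Dilation

/-- The point `r / 2` of `ℚ ∩ [0,1]`. -/
def half (r : RatUnit) : RatUnit := ⟨r / 2, by have := r.2.1; positivity, by linarith [r.2.2]⟩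

theorem half_injective : Function.Injective half := fun r s h => by
  have h1 : (r : ℚ) / 2 = s / 2 := congrArg Subtype.val h
  exact Subtype.ext (by linarith)

theorem norm_single_half (r : RatUnit) :
    ‖(lp.single 2 (half r) (1 : ℂ) : lp (fun _ : RatUnit => ℂ) 2)‖ = 1 := by
  rw [lp.norm_single (by norm_num), norm_one]

theorem orthogonalFamily_half : OrthogonalFamily ℂ (fun _ : RatUnit => ℂ)
    fun r => LinearIsometry.toSpanSingleton ℂ _ (norm_single_half r) := by
  intro r s hrs a b
  simp only [LinearIsometry.toSpanSingleton_apply, inner_smul_left, inner_smul_right,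
    lp.inner_single_left]
  rw [lp.single_apply, Pi.single_eq_of_ne fun h => hrs (half_injective h)]
  simp

/-- The isometry of `ℓ²(ℚ ∩ [0,1])` which maps the basis vector at `r` to the one at `r / 2`. -/
def dilationSeq : lp (fun _ : RatUnit => ℂ) 2 →ₗᵢ[ℂ] lp (fun _ : RatUnit => ℂ) 2 :=
  orthogonalFamily_half.linearIsometry

/-- Pairing the defining sum with the basis vector at s leaves only terms with r/2 = s. Vanishing of
coordinates is all that the nest inclusions need. -/
theorem dilationSeq_apply_eq_zero {x : lp (fun _ : RatUnit => ℂ) 2} {s : RatUnit}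
    (h : ∀ r, half r = s → x r = 0) : dilationSeq x s = 0 := by
  have h1 := (orthogonalFamily_half.hasSum_linearIsometry x).mapL
    (innerSL ℂ (lp.single 2 s (1 : ℂ) : lp (fun _ : RatUnit => ℂ) 2))
  have h2 : ∀ r, innerSL ℂ (lp.single 2 s (1 : ℂ) : lp (fun _ : RatUnit => ℂ) 2)
      (LinearIsometry.toSpanSingleton ℂ _ (norm_single_half r) (x r)) = 0 := by
    intro r
    rw [innerSL_apply_apply, lp.inner_single_left, LinearIsometry.toSpanSingleton_apply]
    by_cases hr : half r = s
    · simp [h r hr]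
    · rw [lp.coeFn_smul, Pi.smul_apply, lp.single_apply, Pi.single_eq_of_ne (Ne.symm hr)]
      simp
  simp only [h2] at h1
  have h3 := h1.unique hasSum_zero
  rw [innerSL_apply_apply, lp.inner_single_left] at h3
  simpa [dilationSeq] using h3

/-- Lebesgue measure on `[0,1/2]`. -/
abbrev lebHalf : Measure ℝ := leb.restrict (Set.Iic (1 / 2))

theorem map_double_lebHalf : lebHalf.map (fun s : ℝ => 2 * s) = ENNReal.ofReal 2⁻¹ • leb := by
  have h : lebHalf = volume.restrict ((fun s : ℝ => 2 * s) ⁻¹' Set.Icc (0 : ℝ) 1) := by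
    rw [lebHalf, leb, Measure.restrict_restrict measurableSet_Iic]
    congr 1
    ext s
    simp only [Set.mem_inter_iff, Set.mem_Iic, Set.mem_Icc, Set.mem_preimage]
    constructor
    · rintro ⟨h1, h2, h3⟩
      constructor <;> linarith
    · rintro ⟨h1, h2⟩
      refine ⟨?_, ?_, ?_⟩ <;> linarith
  rw [h, ← Measure.restrict_map (measurable_const_mul 2) measurableSet_Icc,
    Real.map_volume_mul_left (by norm_num), Measure.restrict_smul]
  norm_num

theorem quasiMeasurePreserving_double :
    Measure.QuasiMeasurePreserving (fun s : ℝ => 2 * s) lebHalf leb :=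
  ⟨measurable_const_mul 2, by
    rw [map_double_lebHalf]
    exact Measure.smul_absolutelyContinuous⟩

theorem memLp_double (f : Lp ℂ 2 leb) : MemLp (fun s => f (2 * s)) 2 lebHalf := by
  refine MemLp.comp_of_map (g := f) ?_ (measurable_const_mul 2).aemeasurable
  rw [map_double_lebHalf]
  exact (Lp.memLp f).smul_measure ENNReal.ofReal_ne_top

/-- Doubling pushes Lebesgue measure on [0,1/2] to half of that on [0,1]; the resulting factor
(1/2)^{1/2} in the L² norm is cancelled by √2. -/
theorem eLpNorm_double (f : Lp ℂ 2 leb) :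
    eLpNorm (((Real.sqrt 2 : ℝ) : ℂ) • fun s => f (2 * s)) 2 lebHalf = eLpNorm f 2 leb := by
  have hae : AEStronglyMeasurable f (lebHalf.map fun s : ℝ => 2 * s) := by
    rw [map_double_lebHalf]
    exact ((Lp.memLp f).smul_measure ENNReal.ofReal_ne_top).1
  have h := eLpNorm_map_measure (p := 2) hae (measurable_const_mul 2).aemeasurable
  rw [map_double_lebHalf, eLpNorm_smul_measure_of_ne_top (by norm_num)] at h
  rw [eLpNorm_const_smul]
  change _ * eLpNorm (f ∘ fun s => 2 * s) 2 lebHalf = _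
  rw [← h, smul_eq_mul, ← mul_assoc]
  have h2 : ‖((Real.sqrt 2 : ℝ) : ℂ)‖ₑ * ENNReal.ofReal 2⁻¹ ^ (1 / (2 : ENNReal)).toReal = 1 := by
    rw [ENNReal.ofReal_rpow_of_pos (by norm_num), ← ofReal_norm, ← ENNReal.ofReal_mul (norm_nonneg _),
      Complex.norm_real, Real.norm_of_nonneg (Real.sqrt_nonneg _)]
    simp only [one_div, ENNReal.toReal_inv, ENNReal.toReal_ofNat]
    rw [← one_div, ← Real.sqrt_eq_rpow, ← Real.sqrt_mul (by norm_num)]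
    norm_num
  rw [h2, one_mul]

theorem memLp_dilation (f : Lp ℂ 2 leb) : MemLp ((Set.Iic (1 / 2)).indicator
    (((Real.sqrt 2 : ℝ) : ℂ) • fun s => f (2 * s))) 2 leb :=
  (memLp_indicator_iff_restrict measurableSet_Iic).2 ((memLp_double f).const_smul _)

theorem ae_lebHalf_iff {P : ℝ → Prop} : (∀ᵐ s ∂lebHalf, P s) ↔ ∀ᵐ s ∂leb, s ≤ 1 / 2 → P s :=
  ae_restrict_iff' measurableSet_Iic

/-- The isometry of `L²[0,1]` which maps `f` to the function equal to `√2 f(2s)` for `s ≤ 1/2`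
and to `0` for `s > 1/2`. -/
def dilationFun : Lp ℂ 2 leb →ₗᵢ[ℂ] Lp ℂ 2 leb where
  toFun f := (memLp_dilation f).toLp _
  map_add' f g := by
    refine Lp.ext ?_
    filter_upwards [(memLp_dilation (f + g)).coeFn_toLp, (memLp_dilation f).coeFn_toLp,
      (memLp_dilation g).coeFn_toLp, Lp.coeFn_add ((memLp_dilation f).toLp _)
        ((memLp_dilation g).toLp _), ae_lebHalf_iff.1 (quasiMeasurePreserving_double.ae
          (Lp.coeFn_add f g))] with s h1 h2 h3 h4 h5
    rw [h1, h4, Pi.add_apply, h2, h3]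
    by_cases hs : s ≤ 1 / 2
    · simp only [Set.indicator_of_mem (show s ∈ Set.Iic (1 / 2) from hs), Pi.smul_apply, h5 hs,
        Pi.add_apply, smul_add]
    · simp only [Set.indicator_of_notMem (show s ∉ Set.Iic (1 / 2) from hs), add_zero]
  map_smul' c f := by
    refine Lp.ext ?_
    filter_upwards [(memLp_dilation (c • f)).coeFn_toLp, (memLp_dilation f).coeFn_toLp,
      Lp.coeFn_smul c ((memLp_dilation f).toLp _), ae_lebHalf_iff.1
        (quasiMeasurePreserving_double.ae (Lp.coeFn_smul c f))] with s h1 h2 h4 h5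
    rw [h1, RingHom.id_apply, h4, Pi.smul_apply, h2]
    by_cases hs : s ≤ 1 / 2
    · simp only [Set.indicator_of_mem (show s ∈ Set.Iic (1 / 2) from hs), Pi.smul_apply, h5 hs]
      rw [smul_comm]
    · simp only [Set.indicator_of_notMem (show s ∉ Set.Iic (1 / 2) from hs), smul_zero]
  norm_map' f := by
    change ‖(memLp_dilation f).toLp _‖ = ‖f‖
    rw [Lp.norm_toLp, Lp.norm_def, eLpNorm_indicator_eq_eLpNorm_restrict measurableSet_Iic]
    exact congrArg _ (eLpNorm_double f)

theorem dilationFun_ae (f : Lp ℂ 2 leb) : dilationFun f =ᵐ[leb] (Set.Iic (1 / 2)).indicator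
    (((Real.sqrt 2 : ℝ) : ℂ) • fun s => f (2 * s)) :=
  (memLp_dilation f).coeFn_toLp

/-- Doubling is quasi-measure-preserving, so an almost everywhere statement pulls back along it.
General P covers both the nest spaces (t < s) and their complements (s ≤ t). -/
theorem dilationFun_ae_eq_zero {f : Lp ℂ 2 leb} {P : ℝ → Prop}
    (h : ∀ᵐ s ∂leb, P s → f s = 0) :
    ∀ᵐ s ∂leb, (s ≤ 1 / 2 → P (2 * s)) → dilationFun f s = 0 := by
  filter_upwards [dilationFun_ae f, ae_lebHalf_iff.1 (quasiMeasurePreserving_double.ae h)]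
    with s h1 h2 h3
  rw [h1]
  by_cases hs : s ≤ 1 / 2
  · rw [Set.indicator_of_mem (show s ∈ Set.Iic (1 / 2) from hs), Pi.smul_apply, h2 hs (h3 hs),
      smul_zero]
  · rw [Set.indicator_of_notMem (show s ∉ Set.Iic (1 / 2) from hs)]

/-- The isometry of `ℓ²(ℚ ∩ [0,1]) ⊕ L²[0,1]` induced by the dilation `s ↦ s / 2`. -/
def dilation : Hsp →ₗᵢ[ℂ] Hsp where
  toFun x := WithLp.toLp 2 (dilationSeq x.fst, dilationFun x.snd)
  map_add' x y := by
    simp only [WithLp.add_fst, WithLp.add_snd, map_add]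
    rfl
  map_smul' c x := by
    simp only [WithLp.smul_fst, WithLp.smul_snd, map_smul, RingHom.id_apply]
    rfl
  norm_map' x := by
    rw [← sq_eq_sq₀ (norm_nonneg _) (norm_nonneg _), WithLp.prod_norm_sq_eq_of_L2,
      WithLp.prod_norm_sq_eq_of_L2]
    change ‖dilationSeq x.fst‖ ^ 2 + ‖dilationFun x.snd‖ ^ 2 = _
    rw [LinearIsometry.norm_map, LinearIsometry.norm_map]

end Dilation

/-! ### The two Delta-embeddings -/

section Embeddings

open ContinuousLinearMap (adjoint)

theorem mem_alg_theNest {x : Hsp →L[ℂ] Hsp} :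
    x ∈ Alg theNest ↔ ∀ l ∈ theNest, ∀ v ∈ l.range, x v ∈ l.range := by
  rw [mem_alg]
  refine forall₂_congr fun l hl => ?_
  constructor
  · rintro h _ ⟨v, rfl⟩
    exact ⟨_, h v⟩
  · intro h v
    exact (mem_range_proj (isStarProjection_of_mem_theNest hl)).1 (h _ ⟨v, rfl⟩)

theorem dilation_mem_nestPlus {t : ℝ} {x : Hsp} (hx : x ∈ (nestPlus t).range) :
    dilation x ∈ (nestPlus (t / 2)).range := by
  rw [mem_range_nestPlus] at hx ⊢
  refine ⟨fun s hs => dilationSeq_apply_eq_zero ?_, ?_⟩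
  · rintro r rfl
    refine hx.1 r ?_
    simp only [half] at hs
    push_cast at hs
    linarith
  · filter_upwards [dilationFun_ae_eq_zero hx.2] with s hs hts
    exact hs fun _ => by linarith

theorem dilation_mem_nestMinus {t : ℝ} {x : Hsp} (hx : x ∈ (nestMinus t).range) :
    dilation x ∈ (nestMinus (t / 2)).range := by
  rw [mem_range_nestMinus] at hx ⊢
  refine ⟨fun s hs => dilationSeq_apply_eq_zero ?_, ?_⟩
  · rintro r rfl
    refine hx.1 r ?_
    simp only [half] at hs
    push_cast at hs
    linarith
  · filter_upwards [dilationFun_ae_eq_zero hx.2] with s hs hts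
    exact hs fun _ => by linarith

theorem dilation_mem_orthogonal_nestPlus {t : ℝ} {x : Hsp} (hx : x ∈ (nestPlus (2 * t)).rangeᗮ) :
    dilation x ∈ (nestPlus t).rangeᗮ := by
  rw [mem_orthogonal_nestPlus] at hx ⊢
  refine ⟨fun s hs => dilationSeq_apply_eq_zero ?_, ?_⟩
  · rintro r rfl
    refine hx.1 r ?_
    simp only [half] at hs
    push_cast at hs
    linarith
  · filter_upwards [dilationFun_ae_eq_zero hx.2] with s hs hts
    exact hs fun _ => by linarith

theorem dilation_mem_orthogonal_nestMinus {t : ℝ} {x : Hsp}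
    (hx : x ∈ (nestMinus (2 * t)).rangeᗮ) : dilation x ∈ (nestMinus t).rangeᗮ := by
  rw [mem_orthogonal_nestMinus] at hx ⊢
  refine ⟨fun s hs => dilationSeq_apply_eq_zero ?_, ?_⟩
  · rintro r rfl
    refine hx.1 r ?_
    simp only [half] at hs
    push_cast at hs
    linarith
  · filter_upwards [dilationFun_ae_eq_zero hx.2] with s hs hts
    exact hs fun _ => by linarith

theorem dilation_mem_nestPlus_half (x : Hsp) : dilation x ∈ (nestPlus (1 / 2)).range := by
  refine dilation_mem_nestPlus ?_
  rw [nestPlus_one]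
  exact ⟨x, rfl⟩

theorem proj_eq_zero_of_mem_orthogonal {H : Type*} [NormedAddCommGroup H] [InnerProductSpace ℂ H]
    [CompleteSpace H] {l : H →L[ℂ] H} (hl : IsStarProjection l) {v : H} (hv : v ∈ l.rangeᗮ) :
    l v = 0 := by
  rw [← inner_self_eq_zero (𝕜 := ℂ), inner_proj_left hl, proj_apply_apply hl, ← inner_proj_left hl]
  exact hv _ ⟨v, rfl⟩

/-- For v in the range of k, ⟪u - lu, U*v⟫ = ⟪U(u - lu), v⟫ = 0. Applied to the dilation, this
controls its adjoint without a formula for it. -/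
theorem adjoint_mem_range {H : Type*} [NormedAddCommGroup H] [InnerProductSpace ℂ H]
    [CompleteSpace H] {U k l : H →L[ℂ] H} (hl : IsStarProjection l)
    (h : ∀ x ∈ l.rangeᗮ, U x ∈ k.rangeᗮ) {v : H} (hv : v ∈ k.range) :
    adjoint U v ∈ l.range := by
  have h1 : ∀ u, u - l u ∈ l.rangeᗮ := by
    rintro u _ ⟨w, rfl⟩
    change ⟪l w, u - l u⟫_ℂ = 0
    rw [inner_proj_left hl, map_sub, proj_apply_apply hl, sub_self, inner_zero_right]
  refine (mem_range_proj hl).2 (ext_inner_left ℂ fun u => ?_)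
  rw [← inner_proj_left hl, ContinuousLinearMap.adjoint_inner_right,
    ContinuousLinearMap.adjoint_inner_right, ← sub_eq_zero, ← inner_sub_left, ← map_sub,
    ← neg_sub, map_neg, inner_neg_left, ← inner_conj_symm, h _ (h1 u) v hv, map_zero, neg_zero]

/-- The isometry `dilation` as an operator. -/
def dilOp : Hsp →L[ℂ] Hsp := dilation.toContinuousLinearMap

theorem dilOp_apply (x : Hsp) : dilOp x = dilation x := rfl

theorem adjoint_dilOp_comp : adjoint dilOp ∘L dilOp = ContinuousLinearMap.id ℂ Hsp :=
  dilation.adjoint_comp_self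

theorem adjoint_dilOp_apply (x : Hsp) : adjoint dilOp (dilOp x) = x :=
  DFunLike.congr_fun adjoint_dilOp_comp x

theorem adjoint_dilOp_mem_nestPlus {t : ℝ} {x : Hsp} (hx : x ∈ (nestPlus t).range) :
    adjoint dilOp x ∈ (nestPlus (2 * t)).range :=
  adjoint_mem_range (k := nestPlus t) (l := nestPlus (2 * t)) (isStarProjection_cutProj _ _)
    (fun x h => by
      rw [dilOp_apply]
      exact dilation_mem_orthogonal_nestPlus h) hx

theorem adjoint_dilOp_mem_nestMinus {t : ℝ} {x : Hsp} (hx : x ∈ (nestMinus t).range) :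
    adjoint dilOp x ∈ (nestMinus (2 * t)).range :=
  adjoint_mem_range (k := nestMinus t) (l := nestMinus (2 * t)) (isStarProjection_cutProj _ _)
    (fun x h => by
      rw [dilOp_apply]
      exact dilation_mem_orthogonal_nestMinus h) hx

theorem dilOp_conj_mem {a : Hsp →L[ℂ] Hsp} (ha : a ∈ Alg theNest) :
    dilOp ∘L a ∘L adjoint dilOp ∈ Alg theNest := by
  rw [mem_alg_theNest] at ha ⊢
  rintro l ⟨t, ht, hl⟩ v hv
  change dilation (a (adjoint dilOp v)) ∈ l.range
  -- For t ≤ 1/2, V* takes level t to level 2t, a preserves level 2t, and V returns to level t. For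
  -- t > 1/2 the whole range of V lies below level t.
  rcases le_or_gt t (1 / 2) with h | h
  · have ht' : 2 * t ∈ Set.Icc (0 : ℝ) 1 := ⟨by linarith [ht.1], by linarith⟩
    have htt : 2 * t / 2 = t := by ring
    rcases hl with rfl | rfl
    · have := dilation_mem_nestPlus (ha _ ⟨2 * t, ht', Or.inl rfl⟩ _ (adjoint_dilOp_mem_nestPlus hv))
      rwa [htt] at this
    · have := dilation_mem_nestMinus
        (ha _ ⟨2 * t, ht', Or.inr rfl⟩ _ (adjoint_dilOp_mem_nestMinus hv))
      rwa [htt] at this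
  · have h1 := dilation_mem_nestPlus_half (a (adjoint dilOp v))
    rcases hl with rfl | rfl
    exacts [nestPlus_le_nestPlus h.le h1, nestPlus_le_nestMinus h h1]

theorem dilOp_conj_mem' {a : Hsp →L[ℂ] Hsp} (ha : a ∈ Alg theNest) :
    adjoint dilOp ∘L a ∘L dilOp ∈ Alg theNest := by
  rw [mem_alg_theNest] at ha ⊢
  rintro l ⟨t, ht, hl⟩ v hv
  change adjoint dilOp (a (dilation v)) ∈ l.range
  have ht' : t / 2 ∈ Set.Icc (0 : ℝ) 1 := ⟨by linarith [ht.1], by linarith [ht.2]⟩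
  have htt : 2 * (t / 2) = t := by ring
  rcases hl with rfl | rfl
  · have := adjoint_dilOp_mem_nestPlus (ha _ ⟨t / 2, ht', Or.inl rfl⟩ _ (dilation_mem_nestPlus hv))
    rwa [htt] at this
  · have := adjoint_dilOp_mem_nestMinus
      (ha _ ⟨t / 2, ht', Or.inr rfl⟩ _ (dilation_mem_nestMinus hv))
    rwa [htt] at this

/-- The projection keeps the coordinates in D', E' and erases the others, so it creates no new
support. -/
theorem cutProj_apply_mem {D D' : Set ℚ} {E E' : Set ℝ} (hE' : MeasurableSet E') {x : Hsp}
    (hx : x ∈ cutSpace D E) : cutProj D' E' x ∈ cutSpace D E := by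
  have h1 : cutProj D' E' x ∈ cutSpace D' E' := by
    rw [← range_cutProj]
    exact ⟨x, rfl⟩
  have h2 : x - cutProj D' E' x ∈ cutSpace D'ᶜ E'ᶜ := by
    rw [← orthogonal_cutSpace D' hE']
    exact Submodule.sub_starProjection_mem_orthogonal x
  refine ⟨fun r hr => ?_, ?_⟩
  · by_cases hr' : (r : ℚ) ∈ D'
    · have h3 : x.fst r - (cutProj D' E' x).fst r = 0 := h2.1 r (fun h => h hr')
      rw [hx.1 r hr, zero_sub, neg_eq_zero] at h3
      exact h3
    · exact h1.1 r hr'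
  · filter_upwards [h1.2, h2.2, hx.2, Lp.coeFn_sub x.snd (cutProj D' E' x).snd] with s h1 h2 h3 h4 hs
    by_cases hs' : s ∈ E'
    · have h5 : (x.snd - (cutProj D' E' x).snd : Lp ℂ 2 leb) s = 0 := h2 (fun h => h hs')
      rw [h4, Pi.sub_apply, h3 hs, zero_sub, neg_eq_zero] at h5
      exact h5
    · exact h1 hs'

theorem isStarProjection_qProj : IsStarProjection qProj := isStarProjection_cutProj _ _

theorem qProj_mem : qProj ∈ Alg theNest := by
  refine mem_alg_theNest.2 ?_
  rintro l ⟨t, ht, rfl | rfl⟩ v hv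
  · rw [nestPlus, range_cutProj] at hv ⊢
    exact cutProj_apply_mem measurableSet_Icc hv
  · rw [nestMinus, range_cutProj] at hv ⊢
    exact cutProj_apply_mem measurableSet_Icc hv

theorem qProj_eq_self_iff {x : Hsp} :
    qProj x = x ↔ ∀ r : RatUnit, (1 / 2 : ℝ) < (r : ℚ) → x.fst r = 0 := by
  rw [qProj, cutProj_eq_self_iff]
  have h : ∀ r : RatUnit, (r : ℚ) ∉ {r : ℚ | 0 ≤ r ∧ r ≤ 1 / 2} ↔ (1 / 2 : ℝ) < (r : ℚ) := by
    intro r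
    have h1 : (1 / 2 : ℝ) < (r : ℚ) ↔ (1 / 2 : ℚ) < r := by
      rw [← Rat.cast_lt (K := ℝ)]
      norm_num
    rw [h1]
    simp [r.2.1]
  constructor
  · exact fun hx r hr => hx.1 r ((h r).2 hr)
  · refine fun hx => ⟨fun r hr => hx r ((h r).1 hr), ?_⟩
    filter_upwards [ae_leb_mem] with s hs hs'
    exact absurd hs hs'

theorem qProj_dilOp (x : Hsp) : qProj (dilOp x) = dilOp x :=
  qProj_eq_self_iff.2 fun r hr =>
    (mem_range_nestPlus.1 (dilation_mem_nestPlus_half x)).1 r hr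

theorem adjoint_dilOp_qProj (x : Hsp) : adjoint dilOp (qProj x) = adjoint dilOp x := by
  refine ext_inner_left ℂ fun u => ?_
  rw [ContinuousLinearMap.adjoint_inner_right, ContinuousLinearMap.adjoint_inner_right,
    ← inner_proj_left isStarProjection_qProj, qProj_dilOp]

/-- The algebra `Alg N` embeds into its corner at `q`. -/
theorem deltaEmbeds_corner : DeltaEmbeds.{0, 0, w} (Alg theNest)
    (corner (Alg theNest) qProj isStarProjection_qProj qProj_mem) := by
  have hmem : ∀ b ∈ Alg theNest, dilOp ∘L b ∘L adjoint dilOp ∈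
      corner (Alg theNest) qProj isStarProjection_qProj qProj_mem := fun b hb =>
    ⟨_, dilOp_conj_mem hb, ContinuousLinearMap.ext fun x => by
      change dilOp (b (adjoint dilOp x)) = qProj (dilOp (b (adjoint dilOp (qProj x))))
      rw [adjoint_dilOp_qProj, qProj_dilOp]⟩
  -- The projection is VV*, which lies in the corner as the conjugate of 1 by V.
  refine DeltaEmbeds.of_partialIsometry (isClosed_corner (isClosed_alg _) _ _ _) (isClosed_alg _)
    (p := dilOp ∘L adjoint dilOp) ⟨?_, ?_⟩
    (hmem 1 (one_mem_alg fun l hl => (isStarProjection_of_mem_theNest hl).isIdempotentElem))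
    dilOp (adjoint dilOp) rfl rfl hmem ?_ ?_ ?_
  · refine ContinuousLinearMap.ext fun x => ?_
    change dilOp (adjoint dilOp (dilOp (adjoint dilOp x))) = dilOp (adjoint dilOp x)
    rw [adjoint_dilOp_apply]
  · change adjoint (dilOp ∘L adjoint dilOp) = _
    rw [ContinuousLinearMap.adjoint_comp, ContinuousLinearMap.adjoint_adjoint]
  · intro b _
    refine ContinuousLinearMap.ext fun x => ?_
    change adjoint dilOp (dilOp (b (adjoint dilOp (dilOp x)))) = b x
    rw [adjoint_dilOp_apply, adjoint_dilOp_apply]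
  · rintro _ ⟨a, ha, rfl⟩
    exact dilOp_conj_mem' ((Alg theNest).mul_mem ((Alg theNest).mul_mem qProj_mem ha) qProj_mem)
  · refine ContinuousLinearMap.ext fun x => ?_
    change dilOp (adjoint dilOp (dilOp x)) = dilOp x
    rw [adjoint_dilOp_apply]

/-- A corner of an algebra embeds into the algebra. -/
theorem corner_deltaEmbeds {H : Type} [NormedAddCommGroup H] [InnerProductSpace ℂ H]
    [CompleteSpace H] {A : NonUnitalSubalgebra ℂ (H →L[ℂ] H)}
    (hA : IsClosed[weakStar H H] (A : Set (H →L[ℂ] H))) {q : H →L[ℂ] H} (hq : IsStarProjection q)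
    (hqA : q ∈ A) : DeltaEmbeds.{0, 0, w} (corner A q hq hqA) A := by
  have hqq := proj_apply_apply hq
  refine DeltaEmbeds.of_partialIsometry hA (isClosed_corner hA _ _ _) hq hqA q q
    hq.isSelfAdjoint hq.isIdempotentElem ?_ ?_ ?_ ?_
  · rintro _ ⟨a, ha, rfl⟩
    exact A.mul_mem hqA (A.mul_mem (A.mul_mem (A.mul_mem hqA ha) hqA) hqA)
  · rintro _ ⟨a, ha, rfl⟩
    refine ContinuousLinearMap.ext fun x => ?_
    change q (q (q (a (q (q (q x)))))) = q (a (q x))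
    simp only [hqq]
  · intro a ha
    exact ⟨a, ha, rfl⟩
  · refine ContinuousLinearMap.ext fun x => ?_
    change q (q (q x)) = q x
    simp only [hqq]

end Embeddings

/-! ### Failure of self-adjointness -/

section NotSelfAdjoint

/-- The rank-one operator taking the basis vector at s to the one at r < s moves down the nest and
is in B; its adjoint moves the vector at r out of `nestPlus r`. -/
theorem not_isSelfAdj {q : Hsp →L[ℂ] Hsp} {B : NonUnitalSubalgebra ℂ (Hsp →L[ℂ] Hsp)}
    (hB : IsCorner (Alg theNest) q B) {r s : RatUnit} (hrs : (r : ℚ) < s)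
    (hr : q (basisVec r) = basisVec r) (hs : q (basisVec s) = basisVec s) : ¬ IsSelfAdj B := by
  intro h
  have hrs' : ((r : ℚ) : ℝ) < (s : ℚ) := by exact_mod_cast hrs
  have hk : nestPlus (r : ℚ) ∈ theNest :=
    ⟨(r : ℚ), ⟨by exact_mod_cast r.2.1, by exact_mod_cast r.2.2⟩, Or.inl rfl⟩
  have hrk : basisVec r ∈ (nestPlus (r : ℚ)).range := by
    rw [nestPlus, range_cutProj]
    exact basisVec_mem r _ ⟨r.2.1, le_rfl⟩
  have hsk : basisVec s ∈ (nestPlus (r : ℚ)).rangeᗮ := by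
    rw [nestPlus, range_cutProj, orthogonal_cutSpace _ measurableSet_Icc]
    exact basisVec_mem s _ fun hs => absurd hs.2 (not_le.2 hrs')
  have hself : ∀ r, ⟪basisVec r, basisVec r⟫_ℂ = 1 := fun r => by
    rw [inner_basisVec]
    change (lp.single 2 r (1 : ℂ) : RatUnit → ℂ) r = 1
    rw [lp.single_apply_self]
  have hx : InnerProductSpace.rankOne ℂ (basisVec r) (basisVec s) ∈ Alg theNest := by
    refine rankOne_mem_alg (fun l hl => isStarProjection_of_mem_theNest hl) fun l hl => ?_
    have hlP := isStarProjection_of_mem_theNest hl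
    rcases theNest_total hk hl with h | h
    · exact Or.inl ((mem_range_proj hlP).1 (h hrk))
    · exact Or.inr (proj_eq_zero_of_mem_orthogonal hlP (Submodule.orthogonal_le h hsk))
  have hxB : InnerProductSpace.rankOne ℂ (basisVec r) (basisVec s) ∈ B := by
    refine (hB.mem_iff _).2 ⟨_, hx, ContinuousLinearMap.ext fun v => ?_⟩
    change _ = q (InnerProductSpace.rankOne ℂ (basisVec r) (basisVec s) (q v))
    rw [InnerProductSpace.rankOne_apply, InnerProductSpace.rankOne_apply, map_smul, hr,
      ← inner_proj_left hB.proj, hs]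
  obtain ⟨a, ha, hxa⟩ := (hB.mem_iff _).1 (h _ hxB)
  have h1 : star (InnerProductSpace.rankOne ℂ (basisVec r) (basisVec s)) ∈ Alg theNest := by
    rw [hxa]
    exact (Alg theNest).mul_mem ((Alg theNest).mul_mem hB.mem ha) hB.mem
  have h2 := mem_alg_theNest.1 h1 _ hk _ hrk
  rw [ContinuousLinearMap.star_eq_adjoint, InnerProductSpace.adjoint_rankOne,
    InnerProductSpace.rankOne_apply, hself, one_smul] at h2
  have h3 := hsk _ h2
  rw [hself] at h3
  exact one_ne_zero h3

end NotSelfAdjoint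

/-! ### Covering pairs in the two annihilator posets -/

section Order

/-- Between any two comparable elements there is a covering pair. -/
def HasDenseCovers (α : Type*) [PartialOrder α] : Prop :=
  ∀ a b : α, a < b → ∃ c d, a ≤ c ∧ c ⋖ d ∧ d ≤ b

theorem HasDenseCovers.of_orderIso {α β : Type*} [PartialOrder α] [PartialOrder β] (e : α ≃o β)
    (h : HasDenseCovers α) : HasDenseCovers β := by
  intro a b hab
  obtain ⟨c, d, hac, hcd, hdb⟩ := h _ _ (e.symm.lt_iff_lt.2 hab)
  exact ⟨e c, e d, e.symm_apply_le.1 hac, (apply_covBy_apply_iff e).2 hcd, e.le_symm_apply.1 hdb⟩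

/-- The element `Q⁺_t ⊕ N_t` of the nest. -/
def plusElt {t : ℝ} (ht : t ∈ Set.Icc (0 : ℝ) 1) : theNest := ⟨nestPlus t, t, ht, Or.inl rfl⟩

/-- The element `Q⁻_t ⊕ N_t` of the nest. -/
def minusElt {t : ℝ} (ht : t ∈ Set.Icc (0 : ℝ) 1) : theNest := ⟨nestMinus t, t, ht, Or.inr rfl⟩

variable {q : Hsp →L[ℂ] Hsp} {B : NonUnitalSubalgebra ℂ (Hsp →L[ℂ] Hsp)}

theorem annih_theNest_le_iff (hB : IsCorner (Alg theNest) q B) (l l' : theNest) :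
    hB.annih isNest_theNest l ≤ hB.annih isNest_theNest l' ↔
      ∀ v ∈ (l' : Hsp →L[ℂ] Hsp).range, q v = v → v ∈ (l : Hsp →L[ℂ] Hsp).range := by
  rw [hB.annih_le_annih_iff]
  refine forall_congr' fun v => ?_
  rw [mem_range_proj (isStarProjection_of_mem_theNest l.2),
    mem_range_proj (isStarProjection_of_mem_theNest l'.2)]

theorem annih_theNest_mono (hB : IsCorner (Alg theNest) q B) {l l' : theNest}
    (h : (l' : Hsp →L[ℂ] Hsp).range ≤ (l : Hsp →L[ℂ] Hsp).range) :
    hB.annih isNest_theNest l ≤ hB.annih isNest_theNest l' :=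
  (annih_theNest_le_iff hB l l').2 fun _ hv _ => h hv

theorem annih_one_le_iff (hB : IsCorner (Alg theNest) 1 B) (l l' : theNest) :
    hB.annih isNest_theNest l ≤ hB.annih isNest_theNest l' ↔
      (l' : Hsp →L[ℂ] Hsp).range ≤ (l : Hsp →L[ℂ] Hsp).range := by
  rw [annih_theNest_le_iff]
  exact ⟨fun h v hv => h v hv rfl, fun h v hv _ => h hv⟩

theorem rat_mem_Icc (r : RatUnit) : ((r : ℚ) : ℝ) ∈ Set.Icc (0 : ℝ) 1 :=
  ⟨by exact_mod_cast r.2.1, by exact_mod_cast r.2.2⟩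

theorem not_nestPlus_le_nestMinus (r : RatUnit) :
    ¬ (nestPlus (r : ℚ)).range ≤ (nestMinus (r : ℚ)).range := by
  intro h
  have h1 : basisVec r ∈ (nestPlus (r : ℚ)).range := by
    rw [nestPlus, range_cutProj]
    exact basisVec_mem r _ ⟨r.2.1, le_rfl⟩
  have h2 : (lp.single 2 r (1 : ℂ) : RatUnit → ℂ) r = 0 :=
    (mem_range_nestMinus.1 (h h1)).1 r le_rfl
  rw [lp.single_apply_self] at h2
  exact one_ne_zero h2

/-- The nest has nothing strictly between `nestMinus r` and `nestPlus r`, which differ by the atom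
at r. Annihilators reverse the order, so the plus element is the lower one. -/
theorem annih_covBy (hB : IsCorner (Alg theNest) 1 B) (r : RatUnit) :
    hB.annih isNest_theNest (plusElt (rat_mem_Icc r)) ⋖
      hB.annih isNest_theNest (minusElt (rat_mem_Icc r)) := by
  refine ⟨lt_of_le_not_ge ((annih_one_le_iff hB _ _).2 (nestMinus_le_nestPlus le_rfl))
    fun h => not_nestPlus_le_nestMinus r ((annih_one_le_iff hB _ _).1 h), fun x h1 h2 => ?_⟩
  obtain ⟨⟨m, hm⟩, rfl⟩ := hB.exists_eq_annih isNest_theNest x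
  have h1' := fun h => h1.not_ge ((annih_one_le_iff hB _ _).2 h)
  have h2' := fun h => h2.not_ge ((annih_one_le_iff hB _ _).2 h)
  change ¬ (nestPlus (r : ℚ)).range ≤ m.range at h1'
  change ¬ m.range ≤ (nestMinus (r : ℚ)).range at h2'
  obtain ⟨t, -, hm⟩ := hm
  rcases lt_trichotomy t (r : ℚ) with h | rfl | h
  · rcases hm with rfl | rfl
    exacts [h2' (nestPlus_le_nestMinus h), h2' (nestMinus_le_nestMinus h.le)]
  · rcases hm with rfl | rfl
    exacts [h1' le_rfl, h2' le_rfl]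
  · rcases hm with rfl | rfl
    exacts [h1' (nestPlus_le_nestPlus h.le), h1' (nestPlus_le_nestMinus h)]

/-- If the parameters differ, any rational between them works. If they agree, the elements are the
plus and minus versions, which differ only at a rational parameter. -/
theorem exists_rat_between {l l' : Hsp →L[ℂ] Hsp} (hl : l ∈ theNest) (hl' : l' ∈ theNest)
    (h : ¬ l.range ≤ l'.range) : ∃ r : RatUnit,
      l'.range ≤ (nestMinus (r : ℚ)).range ∧ (nestPlus (r : ℚ)).range ≤ l.range := by
  obtain ⟨t, ht, hl⟩ := hl
  obtain ⟨t', ht', hl'⟩ := hl'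
  rcases lt_trichotomy t' t with h' | rfl | h'
  · obtain ⟨r, h1, h2⟩ := exists_rat_btwn h'
    refine ⟨⟨r, by exact_mod_cast ht'.1.trans h1.le, by exact_mod_cast h2.le.trans ht.2⟩, ?_, ?_⟩
    · rcases hl' with rfl | rfl
      exacts [nestPlus_le_nestMinus h1, nestMinus_le_nestMinus h1.le]
    · rcases hl with rfl | rfl
      exacts [nestPlus_le_nestPlus h2.le, nestPlus_le_nestMinus h2]
  · rcases hl with rfl | rfl <;> rcases hl' with rfl | rfl
    · exact absurd le_rfl h
    · by_cases hr : ∃ r : RatUnit, ((r : ℚ) : ℝ) = t'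
      · obtain ⟨r, rfl⟩ := hr
        exact ⟨r, le_rfl, le_rfl⟩
      · refine absurd (fun x hx => ?_) h
        rw [mem_range_nestPlus] at hx
        refine mem_range_nestMinus.2 ⟨fun r htr => hx.1 r (lt_of_le_of_ne htr ?_), hx.2⟩
        exact fun h => hr ⟨r, h.symm⟩
    · exact absurd (nestMinus_le_nestPlus le_rfl) h
    · exact absurd le_rfl h
  · refine absurd ?_ h
    rcases hl with rfl | rfl <;> rcases hl' with rfl | rfl
    exacts [nestPlus_le_nestPlus h'.le, nestPlus_le_nestMinus h', nestMinus_le_nestPlus h'.le,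
      nestMinus_le_nestMinus h'.le]

theorem hasDenseCovers_alg (hB : IsCorner (Alg theNest) 1 B) :
    HasDenseCovers (LeftAnnihilators B) := by
  intro a b hab
  obtain ⟨⟨l, hl⟩, rfl⟩ := hB.exists_eq_annih isNest_theNest a
  obtain ⟨⟨l', hl'⟩, rfl⟩ := hB.exists_eq_annih isNest_theNest b
  obtain ⟨r, h1, h2⟩ := exists_rat_between hl hl' fun h =>
    hab.not_ge ((annih_one_le_iff hB _ _).2 h)
  refine ⟨hB.annih isNest_theNest (plusElt (rat_mem_Icc r)),
    hB.annih isNest_theNest (minusElt (rat_mem_Icc r)), ?_, annih_covBy hB r, ?_⟩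
  · rw [annih_one_le_iff]
    exact h2
  · rw [annih_one_le_iff]
    exact h1

/-- The function `1_{[0,s]}`, as an element of `ℓ²(ℚ ∩ [0,1]) ⊕ L²[0,1]`. -/
def stepVec (s : ℝ) : Hsp := cutVec (measurableSet_Icc (a := 0) (b := s))
  (indicatorConstLp 2 MeasurableSet.univ (measure_ne_top leb _) (1 : ℂ))

theorem stepVec_mem (s : ℝ) : stepVec s ∈ (nestPlus s).range := by
  rw [nestPlus, range_cutProj]
  exact cutVec_mem _ _ _

theorem stepVec_snd (s : ℝ) : ∀ᵐ a ∂leb, a ≤ s → (stepVec s).snd a = 1 := by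
  filter_upwards [cutVec_snd (measurableSet_Icc (a := 0) (b := s))
    (indicatorConstLp 2 MeasurableSet.univ (measure_ne_top leb _) (1 : ℂ)),
    indicatorConstLp_coeFn (p := 2) (hs := MeasurableSet.univ)
      (hμs := measure_ne_top leb Set.univ) (c := (1 : ℂ)), ae_leb_mem] with a h1 h2 h3 h4
  change (cutVec _ _).snd a = 1
  rw [h1, Set.indicator_of_mem (show a ∈ Set.Icc 0 s from ⟨h3.1, h4⟩), h2]
  simp

theorem qProj_stepVec (s : ℝ) : qProj (stepVec s) = stepVec s :=
  qProj_eq_self_iff.2 fun _ _ => rfl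

/-- If t < s, the function is 1 on (t, s], a set of positive measure. As q fixes these vectors,
distinct parameters stay distinguishable in the corner. -/
theorem le_of_stepVec_mem {s t : ℝ} (ht : 0 ≤ t) (hs : s ≤ 1)
    (h : stepVec s ∈ (nestPlus t).range) : s ≤ t := by
  by_contra! hts
  have h1 : ∀ᵐ a ∂leb, a ∉ Set.Ioc t s := by
    filter_upwards [stepVec_snd s, (mem_range_nestPlus.1 h).2] with a h1 h2 h3
    have := h2 h3.1
    rw [h1 h3.2] at this
    exact one_ne_zero this
  have h2 : leb (Set.Ioc t s) = 0 := measure_eq_zero_iff_ae_notMem.2 h1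
  have h3 : Set.Ioc t s ⊆ Set.Icc 0 1 := fun a ha => ⟨ht.trans ha.1.le, ha.2.trans hs⟩
  rw [Measure.restrict_apply measurableSet_Ioc, Set.inter_eq_left.2 h3, Real.volume_Ioc, ENNReal.ofReal_eq_zero] at h2
  linarith

theorem not_hasDenseCovers (hB : IsCorner (Alg theNest) qProj B) :
    ¬ HasDenseCovers (LeftAnnihilators B) := by
  intro H
  have h1 : (1 : ℝ) ∈ Set.Icc (0 : ℝ) 1 := by simp
  have h34 : (3 / 4 : ℝ) ∈ Set.Icc (0 : ℝ) 1 := by constructor <;> norm_num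
  have mono := fun l l' => annih_theNest_mono hB (l := l) (l' := l')
  -- Recovers an inequality of parameters from one of annihilators, by testing on the step vector at
  -- s.
  have step : ∀ {s t : ℝ} {l l' : theNest}, s ≤ 1 → 0 ≤ t →
      (nestPlus s).range ≤ (l' : Hsp →L[ℂ] Hsp).range →
      (l : Hsp →L[ℂ] Hsp).range ≤ (nestPlus t).range →
      hB.annih isNest_theNest l ≤ hB.annih isNest_theNest l' → s ≤ t := by
    intro s t l l' hs ht hl' hl h
    exact le_of_stepVec_mem ht hs (hl ((annih_theNest_le_iff hB l l').1 h _ (hl' (stepVec_mem s))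
      (qProj_stepVec s)))
  -- Any level in (1/2, 1) would serve in place of 3/4: beyond 1/2 the compressed nest has no atoms.
  obtain ⟨c, d, -, hcd, hdb⟩ := H (hB.annih isNest_theNest (plusElt h1))
    (hB.annih isNest_theNest (plusElt h34)) (lt_of_le_not_ge
      (mono _ _ (nestPlus_le_nestPlus h34.2)) fun h => by
        have := step (s := 1) (t := 3 / 4) le_rfl h34.1 le_rfl le_rfl h
        norm_num at this)
  obtain ⟨⟨m, hm⟩, rfl⟩ := hB.exists_eq_annih isNest_theNest c
  obtain ⟨⟨m', hm'⟩, rfl⟩ := hB.exists_eq_annih isNest_theNest d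
  obtain ⟨t, ht, hmt⟩ := id hm
  obtain ⟨t', ht', hmt'⟩ := id hm'
  have hm₁ : m.range ≤ (nestPlus t).range := by
    rcases hmt with rfl | rfl
    exacts [le_rfl, nestMinus_le_nestPlus le_rfl]
  have hm₂ : ∀ s < t, (nestPlus s).range ≤ m.range := by
    intro s hs
    rcases hmt with rfl | rfl
    exacts [nestPlus_le_nestPlus hs.le, nestPlus_le_nestMinus hs]
  have hm₁' : m'.range ≤ (nestPlus t').range := by
    rcases hmt' with rfl | rfl
    exacts [le_rfl, nestMinus_le_nestPlus le_rfl]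
  have hm₂' : (nestMinus t').range ≤ m'.range := by
    rcases hmt' with rfl | rfl
    exacts [nestMinus_le_nestPlus le_rfl, le_rfl]
  have h34t : 3 / 4 ≤ t' := step h34.2 ht'.1 le_rfl hm₁' hdb
  -- Were t ≤ t', every vector of m fixed by q would lie in `nestMinus t'`, since q kills the
  -- coordinates at rationals ≥ t' ≥ 3/4 > 1/2. This contradicts strictness of the cover.
  have htt : t' < t := by
    by_contra! h
    refine hcd.lt.not_ge ((annih_theNest_le_iff hB _ _).2 fun v hv hqv => hm₂' ?_)
    have h2 := mem_range_nestPlus.1 (nestPlus_le_nestPlus h (hm₁ hv))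
    refine mem_range_nestMinus.2 ⟨fun r hr => qProj_eq_self_iff.1 hqv r ?_, h2.2⟩
    linarith
  have hu : (t' + t) / 2 ∈ Set.Icc (0 : ℝ) 1 :=
    ⟨by linarith [ht.1, ht'.1], by linarith [ht.2, ht'.2]⟩
  -- The midpoint of t' and t gives an annihilator strictly inside the alleged covering pair.
  refine hcd.2 (c := hB.annih isNest_theNest (plusElt hu))
    (lt_of_le_not_ge (mono _ _ (hm₂ _ (by linarith))) fun h => ?_)
    (lt_of_le_not_ge (mono _ _ (hm₁'.trans (nestPlus_le_nestPlus (by linarith)))) fun h => ?_)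
  -- Since m may be the minus element at t, it is only known to contain `nestPlus s` for s < t, so a
  -- point strictly between the midpoint and t is tested.
  · have := step (s := ((t' + t) / 2 + t) / 2) (t := (t' + t) / 2) (by linarith [ht.2]) hu.1
      (hm₂ _ (by linarith)) le_rfl h
    linarith
  · have := step (s := (t' + t) / 2) (t := t') hu.2 ht'.1 le_rfl hm₁' h
    linarith

end Order

/-! ### Assembly -/

section Main

theorem qProj_basisVec {r : RatUnit} (hr : (r : ℚ) ≤ 1 / 2) : qProj (basisVec r) = basisVec r :=
  cutProj_eq_self_iff.2 (basisVec_mem r _ ⟨r.2.1, hr⟩)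

theorem isUnitalDual_alg : IsUnitalDual (Alg theNest) :=
  ⟨isClosed_alg _, 1, one_mem_alg fun _ hl => (isStarProjection_of_mem_theNest hl).isIdempotentElem,
    IsStarProjection.one _, fun a _ => ⟨one_mul a, mul_one a⟩⟩

theorem isCorner_alg : IsCorner (Alg theNest) 1 (Alg theNest) :=
  isCorner_one _ (one_mem_alg fun _ hl => (isStarProjection_of_mem_theNest hl).isIdempotentElem)

theorem isUnitalDual_qCorner : IsUnitalDual
    (corner (Alg theNest) qProj isStarProjection_qProj qProj_mem) :=
  isUnitalDual_corner (isClosed_alg _) _ _ _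

theorem not_deltaEquiv : ¬ DeltaEquiv.{0, 0, w} (Alg theNest)
    (corner (Alg theNest) qProj isStarProjection_qProj qProj_mem) := by
  intro h
  obtain ⟨e⟩ := h.nonempty_orderIso isUnitalDual_alg isUnitalDual_qCorner
  exact not_hasDenseCovers (isCorner_corner _ _ _ _) ((hasDenseCovers_alg isCorner_alg).of_orderIso e)

end Main

end

end DeltaEmb

theorem mainTheorem6 :
    DeltaEmb.IsNest DeltaEmb.theNest ∧
    DeltaEmb.IsUnitalDual (DeltaEmb.Alg DeltaEmb.theNest) ∧
    (∃ (hq : IsStarProjection DeltaEmb.qProj) (hqA : DeltaEmb.qProj ∈ DeltaEmb.Alg DeltaEmb.theNest),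
      DeltaEmb.IsUnitalDual (DeltaEmb.corner (DeltaEmb.Alg DeltaEmb.theNest) DeltaEmb.qProj hq hqA) ∧
      DeltaEmb.DeltaEmbeds.{0, 0, w} (DeltaEmb.Alg DeltaEmb.theNest)
        (DeltaEmb.corner (DeltaEmb.Alg DeltaEmb.theNest) DeltaEmb.qProj hq hqA) ∧
      DeltaEmb.DeltaEmbeds.{0, 0, w}
        (DeltaEmb.corner (DeltaEmb.Alg DeltaEmb.theNest) DeltaEmb.qProj hq hqA)
        (DeltaEmb.Alg DeltaEmb.theNest) ∧
      ¬ DeltaEmb.DeltaEquiv.{0, 0, w} (DeltaEmb.Alg DeltaEmb.theNest)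
        (DeltaEmb.corner (DeltaEmb.Alg DeltaEmb.theNest) DeltaEmb.qProj hq hqA)) ∧
    ¬ (∀ (H : Type) [NormedAddCommGroup H] [InnerProductSpace ℂ H] [CompleteSpace H]
        (K : Type) [NormedAddCommGroup K] [InnerProductSpace ℂ K] [CompleteSpace K]
        (A : NonUnitalSubalgebra ℂ (H →L[ℂ] H)) (B : NonUnitalSubalgebra ℂ (K →L[ℂ] K)),
        DeltaEmb.IsUnitalDual A → DeltaEmb.IsUnitalDual B →
        ¬ DeltaEmb.IsSelfAdj A → ¬ DeltaEmb.IsSelfAdj B →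
        DeltaEmb.DeltaEmbeds.{0, 0, w} A B → DeltaEmb.DeltaEmbeds.{0, 0, w} B A →
        DeltaEmb.DeltaEquiv.{0, 0, w} A B) := by
  -- Both rationals are at most 1/2, so their basis vectors are fixed by q and the same pair shows
  -- that neither A nor qAq is self-adjoint.
  have hlt : ((⟨0, by norm_num⟩ : DeltaEmb.RatUnit) : ℚ) <
      (⟨1 / 2, by norm_num⟩ : DeltaEmb.RatUnit) := by norm_num
  refine ⟨DeltaEmb.isNest_theNest, DeltaEmb.isUnitalDual_alg,
    ⟨DeltaEmb.isStarProjection_qProj, DeltaEmb.qProj_mem, DeltaEmb.isUnitalDual_qCorner,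
      DeltaEmb.deltaEmbeds_corner, DeltaEmb.corner_deltaEmbeds (DeltaEmb.isClosed_alg _) _ _,
      DeltaEmb.not_deltaEquiv⟩, fun h => ?_⟩
  exact DeltaEmb.not_deltaEquiv (h _ _ _ _ DeltaEmb.isUnitalDual_alg DeltaEmb.isUnitalDual_qCorner
    (DeltaEmb.not_isSelfAdj DeltaEmb.isCorner_alg hlt rfl rfl)
    (DeltaEmb.not_isSelfAdj (DeltaEmb.isCorner_corner _ _ _ _) hlt
      (DeltaEmb.qProj_basisVec (by norm_num)) (DeltaEmb.qProj_basisVec le_rfl))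
    DeltaEmb.deltaEmbeds_corner (DeltaEmb.corner_deltaEmbeds (DeltaEmb.isClosed_alg _) _ _))
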